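/- **Setting.** Let $E$ be a separable complex Banach space, let $n\ge 1$, and let $A_0,\dots,A_{n-1}$ be closed linear operators on $E$. Consider the abstract Cauchy problem $$(ACP_n):\quad u^{(n)}(t)+A_{n-1}u^{(n-1)}(t)+\dots+A_1u'(t)+A_0u(t)=0\ (t\ge 0),\qquad u^{(k)}(0)=u_k\ (0\le k\le n-1).$$ A strong solution is an $n$-times continuously differentiable $u:[0,\infty)\to E$ such that $u^{(i)}(t)\in D(A_i)$ for all $t\ge0$, each $t\mapsto A_iu^{(i)}(t)$ is continuous ($0\le i\le n-1$), and the equation and the initial conditions hold. Let $\Delta$ and $\Psi$ be the operator matrices on $E^n$, with maximal domains, given by $$(\Delta x)_i=-A_{n-i}x_1+x_{i+1}\ (1\le i\le n,\ x_{n+1}:=0),\qquad (\Psi v)_{i+1}=v_i+\sum_{j=1}^{i}A_{n-j}v_{i-j}\quad(0\le i\le n-1,\ v=(v_0,\dots,v_{n-1})).$$ Let $[D(\Delta^n)]$ be $D(\Delta^n)$ with the norm $\sum_{k=0}^n\|\Delta^kx\|$, let $\pi_i:E^n\to E$ be the $i$-th projection, and say that $T\subseteq[0,\infty)$ has positive lower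 density if $\liminf_{t\to\infty}m(T\cap[0,t])/t>0$, where $m$ is Lebesgue measure. **Definition.** Let $\lambda\in\rho(\Delta)$, $\emptyset\ne W\subseteq\{0,\dots,n-1\}$, let $F$ be a linear subspace of $(D(A_{n-1}))^n$ and $\mathcal E=(E_i)_{i\in W}$ a tuple of linear subspaces of $E$. The problem $(ACP_n)$ is $(W,F,\mathcal E,(D(A_{n-1}))^n)$-frequently hypercyclic if there is a strong solution $u$ with initial values $(u_0,\dots,u_{n-1})\in F$, such that the expressions $u^{(i)}(t)+\sum_{j=1}^iA_{n-j}u^{(i-j)}(t)$ are defined for all $t\ge0$ and $i\in W$, and such that the set $$\bigcap_{i\in W}\Bigl\{t\ge 0:\ u^{(i)}(t)+\sum_{j=1}^{i}A_{n-j}u^{(i-j)}(t)\in\pi_{i+1}\bigl((\lambda-\Delta)^{-n}(V)\bigr)\cap E_i\Bigr\}$$ has positive lower density for every open $V\subseteq E^n$ that $F$ meets in the following sense: there is $v\in F$ with $v_i+\sum_{j=1}^{i}A_{n-j}v_{i-j}\in\pi_{i+1}((\lambda-\Delta)^{-n}(V))\cap E_i$ for all $i\in W$. **Theorem 2.2.**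 Suppose that $-A_{n-1}$ generates a $C_0$-semigroup on $E$ and that $D(A_{n-1})\subseteq D(A_j)$ for $0\le j\le n-2$. Let $(F_j)_{j\in\Gamma}$ be a family of twice continuously differentiable mappings $F_j:I_j\to E^n$ on non-degenerate intervals $I_j\subseteq\mathbb R$ such that $F_j(t)\in D(\Delta)$ and $\Delta F_j(t)=itF_j(t)$ for all $t\in I_j$, $j\in\Gamma$. Let $\tilde E$ be the closure of $\operatorname{span}\{F_j(t):j\in\Gamma,\ t\in I_j\}$ in $[D(\Delta^n)]$, and let $\Psi^{-1}(\tilde E)=\{v\in D(\Psi):\Psi v\in\tilde E\}$. Then $\rho(\Delta)\ne\emptyset$, and for every $\lambda\in\rho(\Delta)$ the problem $(ACP_n)$ is $(\{0,\dots,n-1\},\ \Psi^{-1}(\tilde E),\ (\pi_1(\tilde E),\dots,\pi_n(\tilde E)),\ (D(A_{n-1}))^n)$-frequently hypercyclic. -/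

import Mathlib

open Set Filter Topology MeasureTheory

noncomputable section

namespace ACP

/-! ### Unbounded operators: resolvents, powers, graph norms -/

section Operators

variable {X : Type*} [NormedAddCommGroup X] [NormedSpace ℂ X]

/-- `R` is the bounded everywhere defined inverse of `z - T`. -/
structure IsResolventAt (T : X →ₗ.[ℂ] X) (z : ℂ) (R : X →L[ℂ] X) : Prop where
  right_inv : ∀ x : X, ∃ h : R x ∈ T.domain, z • R x - T ⟨R x, h⟩ = x
  left_inv : ∀ x : T.domain, R (z • (x : X) - T x) = x

/-- The resolvent set of `T`. -/
def resolventSet (T : X →ₗ.[ℂ] X) : Set ℂ :=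
  {z | ∃ R : X →L[ℂ] X, IsResolventAt T z R}

/-- The domain of the product `g f`, i.e. `{x ∈ D(f) : f x ∈ D(g)}`. -/
def mulDomain (g f : X →ₗ.[ℂ] X) : Submodule ℂ X :=
  (g.domain.comap f.toFun).map f.domain.subtype

theorem mem_mulDomain (g f : X →ₗ.[ℂ] X) (x : X) :
    x ∈ mulDomain g f ↔ ∃ h : x ∈ f.domain, f ⟨x, h⟩ ∈ g.domain := by
  constructor
  · rintro ⟨y, hy, rfl⟩
    exact ⟨y.2, hy⟩
  · rintro ⟨h, hx⟩
    exact ⟨⟨x, h⟩, hx, rfl⟩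

theorem mulDomain_le (g f : X →ₗ.[ℂ] X) : mulDomain g f ≤ f.domain :=
  fun x hx => ((mem_mulDomain g f x).1 hx).1

/-- The product `x ↦ g (f x)` of two unbounded operators, with domain
`{x ∈ D(f) : f x ∈ D(g)}`. -/
def mulOp (g f : X →ₗ.[ℂ] X) : X →ₗ.[ℂ] X where
  domain := mulDomain g f
  toFun := g.toFun ∘ₗ
    LinearMap.codRestrict g.domain (f.toFun ∘ₗ Submodule.inclusion (mulDomain_le g f))
      (fun x => ((mem_mulDomain g f x).1 x.2).2)

/-- The powers `T ^ k` of an unbounded operator, with their natural domains. -/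
def powOp (T : X →ₗ.[ℂ] X) : ℕ → (X →ₗ.[ℂ] X)
  | 0 => LinearMap.id.toPMap ⊤
  | k + 1 => mulOp T (powOp T k)

theorem powOp_domain_antitone (T : X →ₗ.[ℂ] X) :
    Antitone (fun k => (powOp T k).domain) :=
  antitone_nat_of_succ_le fun k => mulDomain_le T (powOp T k)

/-- The norm `‖x‖_k = ∑_{i ≤ k} ‖T ^ i x‖` of the space `[D(T ^ k)]`. -/
def graphNorm (T : X →ₗ.[ℂ] X) (k : ℕ) : Seminorm ℂ (powOp T k).domain :=
  ∑ i : Fin (k + 1), (normSeminorm ℂ X).comp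
    ((powOp T i).toFun ∘ₗ Submodule.inclusion (powOp_domain_antitone T i.is_le))

/-- The closure of a subspace with respect to the topology of a seminorm. -/
def seminormClosure {Y : Type*} [AddCommGroup Y] [Module ℂ Y] (p : Seminorm ℂ Y)
    (S : Submodule ℂ Y) : Submodule ℂ Y where
  carrier := {x | ∀ ε > 0, ∃ y ∈ S, p (x - y) < ε}
  zero_mem' := fun ε hε => ⟨0, S.zero_mem, by simpa using hε⟩
  add_mem' := by
    intro a b ha hb ε hε
    obtain ⟨y, hy, hay⟩ := ha (ε / 2) (half_pos hε)
    obtain ⟨z, hz, hbz⟩ := hb (ε / 2) (half_pos hε)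
    refine ⟨y + z, S.add_mem hy hz, ?_⟩
    have h := map_add_le_add p (a - y) (b - z)
    rw [sub_add_sub_comm] at h
    linarith
  smul_mem' := by
    intro c a ha ε hε
    have hc : 0 < ‖c‖ + 1 := by positivity
    obtain ⟨y, hy, hay⟩ := ha (ε / (‖c‖ + 1)) (by positivity)
    refine ⟨c • y, S.smul_mem c hy, ?_⟩
    rw [← smul_sub, map_smul_eq_mul]
    calc ‖c‖ * p (a - y) ≤ (‖c‖ + 1) * p (a - y) := by
          gcongr
          linarith
      _ < (‖c‖ + 1) * (ε / (‖c‖ + 1)) := by gcongr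
      _ = ε := by field_simp

/-- The closure in `[D(T ^ k)]` of (the part in `D(T ^ k)` of) a subspace `S` of `X`,
as a subspace of `X`. -/
def graphClosure (T : X →ₗ.[ℂ] X) (k : ℕ) (S : Submodule ℂ X) : Submodule ℂ X :=
  (seminormClosure (graphNorm T k) (S.comap (powOp T k).domain.subtype)).map
    (powOp T k).domain.subtype

/-- `(S(t))_{t ≥ 0}` is a strongly continuous semigroup of bounded operators
(the values at `t < 0` are irrelevant). -/
structure IsC0Semigroup (S : ℝ → X →L[ℂ] X) : Prop where
  zero : S 0 = ContinuousLinearMap.id ℂ X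
  add : ∀ s t : ℝ, 0 ≤ s → 0 ≤ t → S (s + t) = (S s).comp (S t)
  cont : ∀ x : X, ContinuousOn (fun t => S t x) (Ici 0)

/-- `B` is the generator of `(S(t))_{t ≥ 0}`: `x ∈ D(B)` and `B x = y` iff
`(S(h) x - x) / h → y` as `h → 0+`. -/
def IsGeneratorOf (B : X →ₗ.[ℂ] X) (S : ℝ → X →L[ℂ] X) : Prop :=
  ∀ x y : X, (x, y) ∈ B.graph ↔
    Tendsto (fun h : ℝ => h⁻¹ • (S h x - x)) (𝓝[>] 0) (𝓝 y)

/-- `B` generates a strongly continuous semigroup. -/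
def GeneratesC0Semigroup (B : X →ₗ.[ℂ] X) : Prop :=
  ∃ S : ℝ → X →L[ℂ] X, IsC0Semigroup S ∧ IsGeneratorOf B S

end Operators

/-! ### Operator matrices -/

section Matrices

variable {E : Type*} [NormedAddCommGroup E] [NormedSpace ℂ E] {n : ℕ}

/-- A row `x ↦ ∑_j M_j x_j` of an operator matrix, on its maximal domain
`{x : x_j ∈ D(M_j) for all j}`. -/
def opRow (M : Fin n → (E →ₗ.[ℂ] E)) : (Fin n → E) →ₗ.[ℂ] E where
  domain := Submodule.pi univ fun j => (M j).domain
  toFun := ∑ j, (M j).toFun ∘ₗ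
    LinearMap.codRestrict (M j).domain (LinearMap.proj j ∘ₗ Submodule.subtype _)
      (fun x => x.2 j (mem_univ j))

/-- The operator on `E ^ n` given by an operator matrix `(M i j)`, on its maximal domain. -/
def opMatrix (M : Fin n → Fin n → (E →ₗ.[ℂ] E)) : (Fin n → E) →ₗ.[ℂ] (Fin n → E) where
  domain := ⨅ i, (opRow (M i)).domain
  toFun := LinearMap.pi fun i =>
    (opRow (M i)).toFun ∘ₗ Submodule.inclusion (iInf_le _ i)

/-- The identity of `E` as an everywhere defined operator. -/
def idOp : E →ₗ.[ℂ] E := LinearMap.id.toPMap ⊤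

/-- The entries of `Δ`, for the coefficients `A_0, …, A_{n-1}`: the first column is
`(-A_{n-1}, -A_{n-2}, …, -A_0)`, there are identities on the first superdiagonal, and zeros
elsewhere.  (Rows and columns are numbered from `0`, and `Fin.rev i = n - 1 - i`.) -/
def deltaEntry [NeZero n] (A : Fin n → (E →ₗ.[ℂ] E)) (i j : Fin n) : E →ₗ.[ℂ] E :=
  if j = 0 then -A (Fin.rev i) else if (j : ℕ) = i + 1 then idOp else 0

/-- The operator matrix `Δ` on `E ^ n`. -/
def Delta [NeZero n] (A : Fin n → (E →ₗ.[ℂ] E)) : (Fin n → E) →ₗ.[ℂ] (Fin n → E) :=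
  opMatrix (deltaEntry A)

/-- The entries of `Ψ`: the identity on the diagonal and `A_{n-k}` on the `k`-th subdiagonal. -/
def psiEntry (A : Fin n → (E →ₗ.[ℂ] E)) (i j : Fin n) : E →ₗ.[ℂ] E :=
  if h : j < i then A ⟨n - (i - j), by have := i.2; have := Fin.lt_def.1 h; omega⟩
  else if j = i then idOp else 0

/-- The `i`-th row of `Ψ`, i.e. `v ↦ v_i + ∑_{j=1}^{i} A_{n-j} v_{i-j}`. -/
def psiRow (A : Fin n → (E →ₗ.[ℂ] E)) (i : Fin n) : (Fin n → E) →ₗ.[ℂ] E :=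
  opRow (psiEntry A i)

/-- The operator matrix `Ψ` on `E ^ n`. -/
def Psi (A : Fin n → (E →ₗ.[ℂ] E)) : (Fin n → E) →ₗ.[ℂ] (Fin n → E) :=
  opMatrix (psiEntry A)

/-- The preimage `T⁻¹(S) = {x ∈ D(T) : T x ∈ S}` of a subspace. -/
def preimageOp {X Y : Type*} [AddCommGroup X] [Module ℂ X] [AddCommGroup Y] [Module ℂ Y]
    (T : X →ₗ.[ℂ] Y) (S : Submodule ℂ Y) : Submodule ℂ X :=
  (S.comap T.toFun).map T.domain.subtype

end Matrices

/-! ### The abstract Cauchy problem -/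

section Cauchy

variable {E : Type*} [NormedAddCommGroup E] [NormedSpace ℂ E] {n : ℕ}

/-- The `k`-th derivative of `u` on `[0, ∞)` (one-sided at `0`). -/
def der (u : ℝ → E) (k : ℕ) (t : ℝ) : E := iteratedDerivWithin k u (Ici 0) t

/-- The vector `(u(t), u'(t), …, u^{(n-1)}(t))`. -/
def jet (n : ℕ) (u : ℝ → E) (t : ℝ) : Fin n → E := fun k => der u k t

/-- `u` is a strong solution on `[0, ∞)` of
`u^{(n)}(t) + A_{n-1} u^{(n-1)}(t) + ⋯ + A_0 u(t) = 0`, `u^{(k)}(0) = u_k` for `k < n`: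
`u` is `n` times continuously differentiable, `u^{(i)}(t) ∈ D(A_i)`, each `A_i u^{(i)}` is
continuous, and the equation and the initial conditions hold. -/
def IsStrongSolution (A : Fin n → (E →ₗ.[ℂ] E)) (u₀ : Fin n → E) (u : ℝ → E) : Prop :=
  ContDiffOn ℝ n u (Ici 0) ∧
  (∃ w : Fin n → ℝ → E,
    (∀ i, ContinuousOn (w i) (Ici 0)) ∧
    (∀ i, ∀ t ≥ 0, ∃ h : der u i t ∈ (A i).domain, A i ⟨der u i t, h⟩ = w i t) ∧
    (∀ t ≥ 0, der u n t + ∑ i, w i t = 0)) ∧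
  jet n u 0 = u₀

/-- The set `S ∩ [0, ∞)` has positive lower density,
`liminf_{t → ∞} m(S ∩ [0, t]) / t > 0`. -/
def PositiveLowerDensity (S : Set ℝ) : Prop :=
  0 < liminf (fun t : ℝ => volume (S ∩ Icc 0 t) / ENNReal.ofReal t) atTop

/-- The set of times `t ≥ 0` at which, for all `i ∈ W`,
`u^{(i)}(t) + ∑_{j=1}^{i} A_{n-j} u^{(i-j)}(t) ∈ π_i(O) ∩ 𝓔_i`. -/
def visitTimes (A : Fin n → (E →ₗ.[ℂ] E)) (W : Set (Fin n)) (𝓔 : W → Submodule ℂ E)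
    (O : Set (Fin n → E)) (u : ℝ → E) : Set ℝ :=
  {t | 0 ≤ t ∧ ∀ i : W, ∃ h : jet n u t ∈ (psiRow A i).domain,
    psiRow A i ⟨jet n u t, h⟩ ∈ (fun x : Fin n → E => x i) '' O ∩ (𝓔 i : Set E)}

/-- Some `v` in the subspace `F` satisfies
`v_i + ∑_{j=1}^{i} A_{n-j} v_{i-j} ∈ π_i(O) ∩ 𝓔_i` for all `i ∈ W`. -/
def Meets (A : Fin n → (E →ₗ.[ℂ] E)) (W : Set (Fin n)) (F : Submodule ℂ (Fin n → E))
    (𝓔 : W → Submodule ℂ E) (O : Set (Fin n → E)) : Prop :=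
  ∃ v ∈ F, ∀ i : W, ∃ h : v ∈ (psiRow A i).domain,
    psiRow A i ⟨v, h⟩ ∈ (fun x : Fin n → E => x i) '' O ∩ (𝓔 i : Set E)

/-- The problem is `(W, F, 𝓔, D(A_{n-1})^n)`-frequently hypercyclic, with respect to
`z ∈ ρ(Δ)`.  Here `F` is a subspace of `D(A_{n-1})^n`, and the sets `(z - Δ)⁻ⁿ(V)`, `V` open,
which have to be visited frequently are those which the subspace `F` meets. -/
def IsFrequentlyHypercyclic [NeZero n] (A : Fin n → (E →ₗ.[ℂ] E)) (z : ℂ)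
    (W : Set (Fin n)) (F : Submodule ℂ (Fin n → E)) (𝓔 : W → Submodule ℂ E) : Prop :=
  W.Nonempty ∧
  (∀ v ∈ F, ∀ i, v i ∈ (A (Fin.rev 0)).domain) ∧
  ∃ R : (Fin n → E) →L[ℂ] (Fin n → E), IsResolventAt (Delta A) z R ∧
    ∃ (u₀ : Fin n → E) (u : ℝ → E), u₀ ∈ F ∧ IsStrongSolution A u₀ u ∧
      (∀ t ≥ 0, ∀ i ∈ W, jet n u t ∈ (psiRow A i).domain) ∧
      ∀ V : Set (Fin n → E), IsOpen V → Meets A W F 𝓔 ((R ^ n) '' V) →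
        PositiveLowerDensity (visitTimes A W 𝓔 ((R ^ n) '' V) u)

end Cauchy

end ACP

end

/-!
# Frequently hypercyclic higher order Cauchy problems

Let `X = E ^ n`, let `R = (z - Δ)⁻¹`, and let `M` be the closure in `X` of the span of the
eigenvectors `F_j(t)`. The proof rests on four facts.

* `ACP.mem_graphClosure_span_iff`: since `(z - Δ)ⁿ` is an isomorphism of `[D(Δⁿ)]` onto `X` which
  leaves the span of the eigenvectors invariant, the closure `Etilde` in `[D(Δⁿ)]` is `Rⁿ M`.
  It is therefore enough to work in `M`, with the norm of `X`.

* `ACP.exists_frequentlyHypercyclic_orbit`: the space `M` contains a mild solution `x` of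
  `x' = Δ x` which visits every ball of `M` with positive lower density. If `φ` is a bump function
  supported in `I_j`, then the wave packet `G(t) = ∫ exp (i s t) φ(s) F_j(s) ds` is a mild solution
  on the whole of `ℝ`; it decays like `1 / t²`, by two integrations by parts, and the vectors
  `G(0)` span a dense subspace of `M`. The orbit `x` is a superposition of translates
  `G_k(t - τ)` of combinations of wave packets whose initial values are dense in `M`. The times `τ`
  are centres of adjacent slots, of length `2 (k + 1) ^ 4` for a translate of `G_k`, and the label
  `k` is used for a proportion `2 ^ (-(k + 1))` of the slots. So the slots are long enough for the
  tails of the other translates to be of the order of `1 / k` near `τ`, and short enough on average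
  for each `k` to be visited with positive density. As the superposition is an explicit series,
  the semigroup generated by `Δ` is not needed.

* `ACP.IsChain.psiRow_apply` and `ACP.isStrongSolution_of_orbit`: if `y = Rⁿ x`, then
  `u(t) = y(t)_0` has the derivatives `u⁽ᵏ⁾(t) = (Δᵏ y(t))_0` for `k ≤ n`. Telescoping sums show
  that `u` solves the Cauchy problem and that `Ψ` maps its jet to `y(t)`.

* `ACP.resolventSet_Delta_nonempty`: up to a bounded nilpotent shift, `Δ` has only one nonzero
  column, and its resolvent is explicit in terms of that of `-A_{n-1}`. A Neumann series takes care
  of the shift, because `‖(z + A_{n-1})⁻¹‖ = O(1 / z)` and the operators `A_j (z + A_{n-1})⁻¹` are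
  bounded uniformly in `z`.

Finally, if `Ψ v = Rⁿ w` meets the sets `π_i (Rⁿ V)` at the points `Rⁿ p_i`, `p_i ∈ V`, and if
`‖x(t) - w‖` is small, then `p_i + x(t) - w ∈ V`, and `Rⁿ` maps this vector to one with the same
`i`-th coordinate as `y(t)`.
-/

open Set Filter Topology MeasureTheory

noncomputable section

namespace ACP

/-! ### Visiting times -/

/-- The label of the `m`-th visiting time: the exponent of `2` in `m + 1`. Label `k` occurs with
frequency `2 ^ (-(k + 1))`. -/
def visitLabel (m : ℕ) : ℕ := padicValNat 2 (m + 1)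

/-- Half the length of the time slot reserved for the `m`-th visit. -/
def slotRadius (m : ℕ) : ℝ := ((visitLabel m : ℝ) + 1) ^ 4

/-- The `m`-th visiting time: the midpoint of the `m`-th slot, when slots of lengths
`2 * slotRadius i` are laid end to end, starting from `0`. -/
def visitTime (m : ℕ) : ℝ := slotRadius m + 2 * ∑ i ∈ Finset.range m, slotRadius i

theorem one_le_slotRadius (m : ℕ) : 1 ≤ slotRadius m :=
  one_le_pow₀ (by linarith [Nat.cast_nonneg (α := ℝ) (visitLabel m)])

theorem slotRadius_pos (m : ℕ) : 0 < slotRadius m := one_pos.trans_le (one_le_slotRadius m)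

theorem le_sum_slotRadius (m : ℕ) : (m : ℝ) ≤ ∑ i ∈ Finset.range m, slotRadius i := by
  simpa using Finset.card_nsmul_le_sum (Finset.range m) slotRadius 1
    (fun i _ => one_le_slotRadius i)

theorem succ_le_visitTime (m : ℕ) : (m : ℝ) + 1 ≤ visitTime m := by
  have := le_sum_slotRadius m
  have := one_le_slotRadius m
  unfold visitTime
  linarith [Nat.cast_nonneg (α := ℝ) m]

theorem slotRadius_le_visitTime (m : ℕ) : slotRadius m ≤ visitTime m := by
  have := le_sum_slotRadius m
  unfold visitTime
  linarith [Nat.cast_nonneg (α := ℝ) m]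

theorem visitTime_sub_of_lt {m m' : ℕ} (h : m < m') :
    slotRadius m + slotRadius m' ≤ visitTime m' - visitTime m ∧
      (m' : ℝ) - m ≤ visitTime m' - visitTime m := by
  obtain ⟨d, rfl⟩ := Nat.exists_eq_add_of_lt h
  have h1 : ∑ i ∈ Finset.range (m + d + 1), slotRadius i =
      ∑ i ∈ Finset.range m, slotRadius i + slotRadius m +
        ∑ i ∈ Finset.range d, slotRadius (m + 1 + i) := by
    rw [show m + d + 1 = m + 1 + d by ring, Finset.sum_range_add, Finset.sum_range_succ]
  have h2 : (d : ℝ) ≤ ∑ i ∈ Finset.range d, slotRadius (m + 1 + i) := by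
    simpa using Finset.card_nsmul_le_sum (Finset.range d) (fun i => slotRadius (m + 1 + i)) 1
      (fun i _ => one_le_slotRadius _)
  have h3 := one_le_slotRadius m
  have h4 := one_le_slotRadius (m + d + 1)
  have h5 : (0 : ℝ) ≤ d := d.cast_nonneg
  unfold visitTime
  rw [h1]
  push_cast
  constructor <;> linarith

theorem abs_visitTime_sub {m m' : ℕ} (h : m ≠ m') :
    slotRadius m + slotRadius m' ≤ |visitTime m - visitTime m'| ∧
      |(m : ℝ) - m'| ≤ |visitTime m - visitTime m'| := by
  wlog hlt : m < m' generalizing m m'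
  · have := this h.symm (lt_of_le_of_ne (not_lt.1 hlt) h.symm)
    rwa [abs_sub_comm (visitTime m'), abs_sub_comm (m' : ℝ), add_comm] at this
  · obtain ⟨h1, h2⟩ := visitTime_sub_of_lt hlt
    have h3 : (m : ℝ) < m' := by exact_mod_cast hlt
    rw [abs_sub_comm (visitTime m), abs_sub_comm (m : ℝ), abs_of_pos (sub_pos.2 h3)]
    exact ⟨h1.trans (le_abs_self _), h2.trans (le_abs_self _)⟩

/-- The visiting times grow linearly, since the average `∑ k, (k + 1) ^ 4 / 2 ^ (k + 1)` of the
slot radii is finite. -/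
theorem exists_visitTime_le : ∃ K : ℝ, 1 ≤ K ∧ ∀ m, visitTime m ≤ K * (m + 1) := by
  have hs : Summable fun k : ℕ => ((k : ℝ) + 1) ^ 4 / 2 ^ k := by
    have h := (summable_nat_add_iff 1).2
      (summable_pow_mul_geometric_of_norm_lt_one (R := ℝ) 4 (r := 1 / 2) (by norm_num))
    refine (h.mul_left 2).congr fun k => ?_
    push_cast
    rw [one_div, inv_pow, pow_succ 2 k]
    field_simp
  set K₀ := ∑' k : ℕ, ((k : ℝ) + 1) ^ 4 / 2 ^ k
  have hsum (M : ℕ) : ∑ i ∈ Finset.range M, slotRadius i ≤ K₀ * M := by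
    calc ∑ i ∈ Finset.range M, slotRadius i
        ≤ ∑ i ∈ Finset.range M, ∑ k ∈ Finset.range M,
            if 2 ^ k ∣ i + 1 then ((k : ℝ) + 1) ^ 4 else 0 := by
          refine Finset.sum_le_sum fun i hi => ?_
          have hk : visitLabel i ∈ Finset.range M := by
            have h1 : 2 ^ visitLabel i ≤ i + 1 := Nat.le_of_dvd i.succ_pos pow_padicValNat_dvd
            have h2 := Nat.lt_two_pow_self (n := visitLabel i)
            have h3 := Finset.mem_range.1 hi
            exact Finset.mem_range.2 (by omega)
          refine le_trans (le_of_eq ?_) (Finset.single_le_sum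
            (f := fun k : ℕ => if 2 ^ k ∣ i + 1 then ((k : ℝ) + 1) ^ 4 else 0)
            (fun k _ => by positivity) hk)
          rw [if_pos (show 2 ^ visitLabel i ∣ i + 1 from pow_padicValNat_dvd), slotRadius]
      _ = ∑ k ∈ Finset.range M, ((k : ℝ) + 1) ^ 4 * (M / 2 ^ k : ℕ) := by
          rw [Finset.sum_comm]
          refine Finset.sum_congr rfl fun k _ => ?_
          rw [← Nat.card_multiples, ← Finset.sum_filter, Finset.sum_const, nsmul_eq_mul, mul_comm]
      _ ≤ ∑ k ∈ Finset.range M, ((k : ℝ) + 1) ^ 4 / 2 ^ k * M := by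
          refine Finset.sum_le_sum fun k _ => ?_
          have : ((M / 2 ^ k : ℕ) : ℝ) ≤ (M : ℝ) / 2 ^ k := by
            simpa using Nat.cast_div_le (α := ℝ) (m := M) (n := 2 ^ k)
          calc ((k : ℝ) + 1) ^ 4 * (M / 2 ^ k : ℕ) ≤ ((k : ℝ) + 1) ^ 4 * (M / 2 ^ k) := by gcongr
            _ = _ := by ring
      _ ≤ K₀ * M := by
          rw [← Finset.sum_mul]
          gcongr
          exact hs.sum_le_tsum _ fun k _ => by positivity
  refine ⟨max 1 (2 * K₀), le_max_left _ _, fun m => ?_⟩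
  have h1 := hsum (m + 1)
  rw [Finset.sum_range_succ] at h1
  have h2 : 2 * K₀ * (m + 1) ≤ max 1 (2 * K₀) * (m + 1) := by
    gcongr
    exact le_max_right _ _
  have h3 := slotRadius_pos m
  unfold visitTime
  push_cast at h1
  linarith

/-- Each label recurs often enough for the associated visits to have positive lower density. -/
theorem positiveLowerDensity_of_visits {S : Set ℝ} (k : ℕ) {δ : ℝ} (hδ : 0 < δ) (hδ1 : δ ≤ 1)
    (hS : ∀ m, visitLabel m = k → Icc (visitTime m) (visitTime m + δ) ⊆ S) :
    PositiveLowerDensity S := by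
  obtain ⟨K, hK1, hK⟩ := exists_visitTime_le
  -- the indices carrying the label `k` are `2 ^ k * (2 * q + 1) - 1`
  let idx : ℕ → ℕ := fun q => 2 ^ k * (2 * q + 1) - 1
  have hidx (q : ℕ) : idx q + 1 = 2 ^ k * (2 * q + 1) :=
    Nat.sub_add_cancel (show 0 < 2 ^ k * (2 * q + 1) by positivity)
  have hlab (q : ℕ) : visitLabel (idx q) = k := by
    rw [visitLabel, hidx, padicValNat.mul (by positivity) (by positivity), padicValNat.prime_pow,
      padicValNat.eq_zero_of_not_dvd (by omega), add_zero]
  have hinj : Function.Injective idx := fun p q h => by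
    have h1 : 2 ^ k * (2 * p + 1) = 2 ^ k * (2 * q + 1) := by rw [← hidx, ← hidx, h]
    have h2 := Nat.eq_of_mul_eq_mul_left (by positivity) h1
    omega
  set P : ℝ := K * 2 ^ (k + 1) with hP
  have hPpos : 1 ≤ P := one_le_mul_of_one_le_of_one_le hK1 (one_le_pow₀ (by norm_num))
  have htime (q : ℕ) : visitTime (idx q) ≤ P * (q + 1) := by
    have h1 : ((idx q : ℝ) + 1) = 2 ^ k * (2 * q + 1) := by exact_mod_cast hidx q
    refine (hK _).trans ?_
    rw [h1, hP, pow_succ]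
    have : 0 < K * 2 ^ k := by positivity
    nlinarith
  have hPpos' : 0 < P := by linarith
  have hdisj : Pairwise (Function.onFun Disjoint
      fun q => Ico (visitTime (idx q)) (visitTime (idx q) + δ)) := by
    intro p q hpq
    wlog hlt : idx p < idx q generalizing p q
    · exact (this hpq.symm (lt_of_le_of_ne (not_lt.1 hlt) (hinj.ne hpq.symm))).symm
    have h1 := (visitTime_sub_of_lt hlt).1
    have h2 := one_le_slotRadius (idx p)
    have h3 := slotRadius_pos (idx q)
    refine Set.disjoint_left.2 fun t ht ht' => ?_
    linarith [ht.2, ht'.1]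
  refine lt_of_lt_of_le (ENNReal.ofReal_pos.2 (div_pos hδ (by linarith : 0 < 2 * P)))
    (le_liminf_of_le (by isBoundedDefault) ?_)
  filter_upwards [eventually_ge_atTop (2 * (P + 1))] with t ht
  have htpos : 0 < t := by linarith
  set Q := ⌊(t - 1) / P⌋₊
  have hQ1 : P * Q ≤ t - 1 := by
    have := Nat.floor_le (a := (t - 1) / P) (div_nonneg (by linarith) (by linarith))
    rwa [le_div_iff₀' (by linarith)] at this
  have hQ2 : t - 1 < P * (Q + 1) := by
    have := Nat.lt_floor_add_one ((t - 1) / P)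
    rwa [div_lt_iff₀' (by linarith)] at this
  have hsub : (⋃ q ∈ Finset.range Q, Ico (visitTime (idx q)) (visitTime (idx q) + δ)) ⊆
      S ∩ Icc 0 t := by
    refine iUnion₂_subset fun q hq s hs => ?_
    have hq' : (q : ℝ) + 1 ≤ Q := by exact_mod_cast Finset.mem_range.1 hq
    have h1 : P * (q + 1) ≤ P * Q := by gcongr
    have h2 := htime q
    have h3 := succ_le_visitTime (idx q)
    have h4 := Nat.cast_nonneg (α := ℝ) (idx q)
    exact ⟨hS _ (hlab q) (Ico_subset_Icc_self hs), by linarith [hs.1], by linarith [hs.2]⟩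
  have hvol : ENNReal.ofReal (Q * δ) ≤ volume (S ∩ Icc 0 t) := by
    refine le_trans (le_of_eq ?_) (measure_mono hsub)
    rw [measure_biUnion_finset (fun p _ q _ h => hdisj h) (fun _ _ => measurableSet_Ico)]
    simp only [Real.volume_Ico, add_sub_cancel_left, Finset.sum_const, Finset.card_range,
      nsmul_eq_mul]
    rw [ENNReal.ofReal_mul Q.cast_nonneg, ENNReal.ofReal_natCast]
  rw [ENNReal.le_div_iff_mul_le (by simp [htpos]) (by simp), ← ENNReal.ofReal_mul (by positivity)]
  refine le_trans (ENNReal.ofReal_le_ofReal ?_) hvol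
  rw [div_mul_eq_mul_div, div_le_iff₀ (by positivity)]
  have : t ≤ Q * (2 * P) := by nlinarith
  nlinarith

/-! ### Sums of translates of decaying functions -/

theorem one_add_sq_le_mul_shift {s T D : ℝ} (hs : |s| ≤ T) :
    1 + D ^ 2 ≤ 2 * (1 + T ^ 2) * (1 + (s - D) ^ 2) := by
  have h1 : s ^ 2 ≤ T ^ 2 := sq_le_sq' (abs_le.1 hs).1 (abs_le.1 hs).2
  nlinarith [sq_nonneg (2 * s - D), mul_nonneg (sq_nonneg T) (sq_nonneg (s - D))]

/-- A quadratically decaying tail of size `l`, evaluated at a distance `|D|` which is at least `d`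
and at least `(k * l) ^ 2`, is of the order of `1 / k`, and summable in terms of `d`. -/
theorem mul_tail_le {s T D d k l : ℝ} (hs : |s| ≤ T) (hd : 0 < d) (hdD : d ≤ |D|)
    (hkl : (k * l) ^ 2 ≤ |D|) :
    k * (l / (1 + (s - D) ^ 2)) ≤ 2 * (1 + T ^ 2) * d ^ (-(3 / 2) : ℝ) := by
  have h1 := one_add_sq_le_mul_shift (D := D) hs
  have hDpos : 0 < |D| := hd.trans_le hdD
  have h2 : k * l ≤ |D| ^ (1 / 2 : ℝ) := by
    rw [← Real.sqrt_eq_rpow]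
    exact Real.le_sqrt_of_sq_le hkl
  have h4 : 0 < d ^ (3 / 2 : ℝ) := by positivity
  have h3 : k * l * d ^ (3 / 2 : ℝ) ≤ D ^ 2 := by
    calc k * l * d ^ (3 / 2 : ℝ) ≤ |D| ^ (1 / 2 : ℝ) * |D| ^ (3 / 2 : ℝ) := by gcongr
      _ = D ^ 2 := by
        rw [← Real.rpow_add hDpos, ← sq_abs]
        norm_num
  rw [Real.rpow_neg hd.le, ← mul_div_assoc, div_le_iff₀ (by positivity), mul_right_comm,
    ← div_eq_mul_inv, le_div_iff₀ h4]
  linarith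

variable {X : Type*} [NormedAddCommGroup X]

/-- The superposition of translates of the functions `G k`: the one with the label of the `m`-th
visiting time is translated to that time. -/
def visitSum (G : ℕ → ℝ → X) (t : ℝ) : X := ∑' m, G (visitLabel m) (t - visitTime m)

/-- The summable majorant, on `[-T, T]`, of the translates in `visitSum`. -/
def translateBound (T : ℝ) (m : ℕ) : ℝ :=
  2 * (1 + T ^ 2) * |(((m : ℤ) + 1 : ℤ) : ℝ)| ^ (-(3 / 2) : ℝ)

theorem summable_translateBound (T : ℝ) : Summable (translateBound T) := by
  have hinj : Function.Injective fun m : ℕ => (m : ℤ) + 1 := fun a b h => by simpa using h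
  have h : Summable fun m : ℕ => |(((m : ℤ) + 1 : ℤ) : ℝ)| ^ (-(3 / 2) : ℝ) :=
    (Real.summable_abs_int_rpow (b := 3 / 2) (by norm_num)).comp_injective hinj
  exact h.mul_left _

theorem norm_translate_le {G : ℕ → ℝ → X} (hG : ∀ k t, ‖G k t‖ ≤ (k + 1) / (1 + t ^ 2))
    {T t : ℝ} (ht : |t| ≤ T) (m : ℕ) :
    ‖G (visitLabel m) (t - visitTime m)‖ ≤ translateBound T m := by
  have h1 := (succ_le_visitTime m).trans (le_abs_self _)
  have h2 := (slotRadius_le_visitTime m).trans (le_abs_self _)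
  have h3 : (0 : ℝ) ≤ m := m.cast_nonneg
  refine (hG _ _).trans ?_
  have h4 : (1 : ℝ) ≤ visitLabel m + 1 := by simp
  have h5 : (1 * ((visitLabel m : ℝ) + 1)) ^ 2 ≤ slotRadius m := by
    rw [one_mul]
    exact pow_le_pow_right₀ h4 (by norm_num)
  have h6 := mul_tail_le ht (by positivity) h1 (h5.trans h2)
  rw [one_mul] at h6
  refine h6.trans (le_of_eq ?_)
  rw [translateBound]
  push_cast
  rw [abs_of_nonneg (by positivity)]

section Complete

variable [CompleteSpace X]

theorem summable_translate {G : ℕ → ℝ → X} (hG : ∀ k t, ‖G k t‖ ≤ (k + 1) / (1 + t ^ 2)) (t : ℝ) :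
    Summable fun m => G (visitLabel m) (t - visitTime m) :=
  Summable.of_norm_bounded (summable_translateBound |t|) (norm_translate_le hG le_rfl)

theorem continuous_visitSum {G : ℕ → ℝ → X} (hG : ∀ k t, ‖G k t‖ ≤ (k + 1) / (1 + t ^ 2))
    (hc : ∀ k, Continuous (G k)) : Continuous (visitSum G) := by
  refine continuous_iff_continuousAt.2 fun t₀ => ?_
  have h : ContinuousOn (visitSum G) (Icc (-(|t₀| + 1)) (|t₀| + 1)) :=
    continuousOn_tsum (fun m => by fun_prop) (summable_translateBound (|t₀| + 1))
      fun m t ht => norm_translate_le hG (abs_le.2 ht) m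
  exact h.continuousAt (Icc_mem_nhds (by linarith [neg_abs_le t₀]) (by linarith [le_abs_self t₀]))

theorem hasDerivAt_visitSum [NormedSpace ℝ X] {H H' : ℕ → ℝ → X} {c : ℝ}
    (hH : ∀ t, Summable fun m => H (visitLabel m) (t - visitTime m))
    (hH' : ∀ k t, ‖H' k t‖ ≤ c * ((k + 1) / (1 + t ^ 2)))
    (hd : ∀ k t, HasDerivAt (H k) (H' k t) t) (t : ℝ) :
    HasDerivAt (visitSum H) (visitSum H' t) t := by
  have ht : t ∈ Ioo (-(|t| + 1)) (|t| + 1) :=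
    ⟨by linarith [neg_abs_le t], by linarith [le_abs_self t]⟩
  have hc : 0 ≤ c := by
    have h := (norm_nonneg _).trans (hH' 0 0)
    norm_num at h
    exact h
  have hderiv (m : ℕ) (s : ℝ) : HasDerivAt (fun s => H (visitLabel m) (s - visitTime m))
      (H' (visitLabel m) (s - visitTime m)) s :=
    (hd (visitLabel m) (s - visitTime m)).comp_sub_const s (visitTime m)
  have hbound (m : ℕ) (s : ℝ) (hs : s ∈ Ioo (-(|t| + 1)) (|t| + 1)) :
      ‖H' (visitLabel m) (s - visitTime m)‖ ≤ c * translateBound (|t| + 1) m := by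
    refine (hH' _ _).trans (mul_le_mul_of_nonneg_left ?_ hc)
    have h := norm_translate_le (G := fun k t => ((k + 1) / (1 + t ^ 2) : ℝ))
      (fun k t => (Real.norm_of_nonneg (by positivity)).le)
      (abs_le.2 (Ioo_subset_Icc_self hs)) m
    exact (le_abs_self _).trans h
  exact hasDerivAt_tsum_of_isPreconnected ((summable_translateBound (|t| + 1)).mul_left c)
    isOpen_Ioo isPreconnected_Ioo (fun m s _ => hderiv m s) hbound ht (hH t) ht

/-- Just after the `m`-th visiting time, the superposition is close to the function which is
translated to that time, the more so the larger the label. -/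
theorem exists_norm_visitSum_sub_le : ∃ C : ℝ, ∀ G : ℕ → ℝ → X,
    (∀ k t, ‖G k t‖ ≤ (k + 1) / (1 + t ^ 2)) → ∀ m, ∀ s ∈ Icc (0 : ℝ) 1,
      ‖visitSum G (visitTime m + s) - G (visitLabel m) s‖ ≤ C / (visitLabel m + 1) := by
  have hsum := Real.summable_abs_int_rpow (b := 3 / 2) (by norm_num)
  refine ⟨4 * ∑' d : ℤ, |(d : ℝ)| ^ (-(3 / 2) : ℝ), fun G hG m s hs => ?_⟩
  have hinj : Function.Injective fun m' : ℕ => (m : ℤ) - m' := fun a b h => by simpa using h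
  rw [visitSum, (summable_translate hG _).tsum_eq_add_tsum_ite m, add_sub_cancel_left,
    add_sub_cancel_left]
  have hbound (m' : ℕ) :
      ‖if m' = m then 0 else G (visitLabel m') (visitTime m + s - visitTime m')‖ ≤
        4 / (visitLabel m + 1) * |(((m : ℤ) - m' : ℤ) : ℝ)| ^ (-(3 / 2) : ℝ) := by
    split_ifs with h
    · rw [norm_zero]
      positivity
    · obtain ⟨h1, h2⟩ := abs_visitTime_sub h
      have h3 : 0 < |(m' : ℝ) - m| := abs_pos.2 (sub_ne_zero.2 (by exact_mod_cast h))
      have h4 : (((visitLabel m : ℝ) + 1) * (visitLabel m' + 1)) ^ 2 ≤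
          |visitTime m' - visitTime m| := by
        refine le_trans ?_ h1
        unfold slotRadius
        nlinarith [sq_nonneg (((visitLabel m : ℝ) + 1) ^ 2 - (visitLabel m' + 1) ^ 2),
          sq_nonneg (((visitLabel m : ℝ) + 1) * (visitLabel m' + 1))]
      have h5 := mul_tail_le (s := s) (T := 1) (abs_le.2 ⟨by linarith [hs.1], hs.2⟩) h3 h2 h4
      refine (hG _ _).trans ?_
      push_cast
      rw [show visitTime m + s - visitTime m' = s - (visitTime m' - visitTime m) by ring,
        abs_sub_comm (m : ℝ), div_mul_eq_mul_div, le_div_iff₀' (by positivity)]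
      linarith
  have hcomp : Summable fun m' : ℕ => |(((m : ℤ) - m' : ℤ) : ℝ)| ^ (-(3 / 2) : ℝ) :=
    hsum.comp_injective hinj
  have hsum' := hcomp.mul_left (4 / ((visitLabel m : ℝ) + 1))
  refine (tsum_of_norm_bounded hsum'.hasSum hbound).trans ?_
  rw [tsum_mul_left, div_mul_eq_mul_div]
  gcongr
  exact tsum_comp_le_tsum_of_inj hsum (fun _ => by positivity) hinj

end Complete

/-! ### Wave packets of eigenvectors -/

section WavePackets

variable {X : Type*} [NormedAddCommGroup X] [NormedSpace ℂ X]

/-- A trajectory `t ↦ G t`, `t ∈ ℝ`, in the subspace `M` which solves `x' = T x` in the mild sense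
and decays quadratically. If `R` is the resolvent of `T` at `z`, then `T R = z R - 1`, so that
being a mild solution is expressed by the bounded operator `R` alone. -/
structure IsDecayingOrbit (R : X →L[ℂ] X) (z : ℂ) (M : Submodule ℂ X) (C : ℝ) (G : ℝ → X) :
    Prop where
  continuous : Continuous G
  mem : ∀ t, G t ∈ M
  bound : ∀ t, ‖G t‖ ≤ C / (1 + t ^ 2)
  hasDerivAt : ∀ t, HasDerivAt (fun t => R (G t)) (z • R (G t) - G t) t

namespace IsDecayingOrbit

variable {R : X →L[ℂ] X} {z : ℂ} {M : Submodule ℂ X} {C C' : ℝ} {G G' : ℝ → X}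

theorem mono (h : IsDecayingOrbit R z M C G) (hC : C ≤ C') : IsDecayingOrbit R z M C' G :=
  ⟨h.continuous, h.mem, fun t => (h.bound t).trans (by gcongr), h.hasDerivAt⟩

theorem zero : IsDecayingOrbit R z M 0 fun _ => 0 where
  continuous := continuous_const
  mem _ := M.zero_mem
  bound t := by simp
  hasDerivAt t := by simpa using hasDerivAt_const t (0 : X)

theorem add (h : IsDecayingOrbit R z M C G) (h' : IsDecayingOrbit R z M C' G') :
    IsDecayingOrbit R z M (C + C') fun t => G t + G' t where
  continuous := h.continuous.add h'.continuous
  mem t := M.add_mem (h.mem t) (h'.mem t)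
  bound t := by
    rw [add_div]
    exact (norm_add_le _ _).trans (add_le_add (h.bound t) (h'.bound t))
  hasDerivAt t := by
    have := (h.hasDerivAt t).add (h'.hasDerivAt t)
    convert! this using 1
    · ext s
      simp
    · simp only [map_add, smul_add]
      abel

theorem smul (h : IsDecayingOrbit R z M C G) (c : ℂ) :
    IsDecayingOrbit R z M (‖c‖ * C) fun t => c • G t where
  continuous := h.continuous.const_smul c
  mem t := M.smul_mem c (h.mem t)
  bound t := by
    rw [norm_smul, mul_div_assoc]
    exact mul_le_mul_of_nonneg_left (h.bound t) (norm_nonneg _)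
  hasDerivAt t := by
    have := (h.hasDerivAt t).const_smul c
    convert! this using 1
    · ext s
      simp
    · simp only [map_smul, smul_sub, smul_comm c z]

end IsDecayingOrbit

/-- The initial values of the decaying orbits in `M`. -/
def decayingInitialValues (R : X →L[ℂ] X) (z : ℂ) (M : Submodule ℂ X) : Submodule ℂ X where
  carrier := {v | ∃ C G, IsDecayingOrbit R z M C G ∧ G 0 = v}
  zero_mem' := ⟨0, _, .zero, rfl⟩
  add_mem' := by
    rintro _ _ ⟨C, G, h, rfl⟩ ⟨C', G', h', rfl⟩
    exact ⟨_, _, h.add h', rfl⟩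
  smul_mem' := by
    rintro c _ ⟨C, G, h, rfl⟩
    exact ⟨_, _, h.smul c, rfl⟩

/-- The wave packet `t ↦ ∫ exp (i s t) ψ(s) ds`, written in terms of the Fourier transform. -/
def wavePacket (ψ : ℝ → X) (t : ℝ) : X :=
  FourierTransform.fourier ψ (-(2 * Real.pi)⁻¹ * t)

theorem integrable_of_contDiff {ψ : ℝ → X} (hψ : ContDiff ℝ 2 ψ) (hc : HasCompactSupport ψ) :
    Integrable ψ := hψ.continuous.integrable_of_hasCompactSupport hc

theorem exists_norm_wavePacket_le {ψ : ℝ → X} (hψ : ContDiff ℝ 2 ψ) (hc : HasCompactSupport ψ) :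
    ∃ C, ∀ t, ‖wavePacket ψ t‖ ≤ C / (1 + t ^ 2) := by
  have hψ1 : ContDiff ℝ 1 (deriv ψ) := ((contDiff_succ_iff_deriv (n := 1)).1 hψ).2.2
  have hψ2 : Continuous (deriv (deriv ψ)) := hψ1.continuous_deriv le_rfl
  have hi := integrable_of_contDiff hψ hc
  have hi1 : Integrable (deriv ψ) := hψ1.continuous.integrable_of_hasCompactSupport hc.deriv
  have hi2 : Integrable (deriv (deriv ψ)) :=
    hψ2.integrable_of_hasCompactSupport hc.deriv.deriv
  refine ⟨(∫ s, ‖ψ s‖) + ∫ s, ‖deriv (deriv ψ) s‖, fun t => ?_⟩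
  set x := -(2 * Real.pi)⁻¹ * t
  have hx : (2 * Real.pi * Complex.I * x : ℂ) * (2 * Real.pi * Complex.I * x) = -(t ^ 2 : ℝ) := by
    have : (2 * Real.pi * Complex.I * x : ℂ) = -(Complex.I * t) := by
      have hpi : (Real.pi : ℂ) ≠ 0 := by exact_mod_cast Real.pi_ne_zero
      simp only [x]
      push_cast
      field_simp
    rw [this]
    push_cast
    linear_combination (t : ℂ) ^ 2 * Complex.I_mul_I
  have h1 : FourierTransform.fourier (deriv (deriv ψ)) x =
      -((t ^ 2 : ℝ) : ℂ) • FourierTransform.fourier ψ x := by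
    rw [Real.fourier_deriv hi1 (hψ1.differentiable one_ne_zero) hi2,
      Real.fourier_deriv hi (hψ.differentiable two_ne_zero) hi1]
    simp only [smul_smul, hx]
  have h2 : ((1 + t ^ 2 : ℝ) : ℂ) • wavePacket ψ t =
      FourierTransform.fourier ψ x - FourierTransform.fourier (deriv (deriv ψ)) x := by
    rw [h1, wavePacket, neg_smul, sub_neg_eq_add, Complex.ofReal_add, add_smul, Complex.ofReal_one,
      one_smul]
  have h3 := congrArg norm h2
  rw [norm_smul, Complex.norm_real, Real.norm_of_nonneg (by positivity)] at h3
  rw [le_div_iff₀' (by positivity), h3]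
  exact (norm_sub_le _ _).trans (add_le_add
    (VectorFourier.norm_fourierIntegral_le_integral_norm _ _ _ _ _)
    (VectorFourier.norm_fourierIntegral_le_integral_norm _ _ _ _ _))

theorem wavePacket_zero (ψ : ℝ → X) : wavePacket ψ 0 = ∫ s, ψ s := by
  rw [wavePacket, Real.fourier_real_eq_integral_exp_smul]
  simp

theorem map_fourier [CompleteSpace X] (R : X →L[ℂ] X) {f : ℝ → X} (hf : Integrable f) (w : ℝ) :
    R (FourierTransform.fourier f w) = FourierTransform.fourier (fun s => R (f s)) w := by
  simp only [Real.fourier_eq]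
  rw [← R.integral_comp_comm ((Real.fourierIntegral_convergent_iff w).2 hf)]
  simp [Circle.smul_def]

/-- If `ψ(s)` is an eigenvector for the eigenvalue `i s`, its wave packet is a mild solution. -/
theorem hasDerivAt_wavePacket [CompleteSpace X] {R : X →L[ℂ] X} {z : ℂ} {ψ : ℝ → X}
    (hψ : Continuous ψ) (hc : HasCompactSupport ψ)
    (heig : ∀ s : ℝ, (Complex.I * s) • R (ψ s) = z • R (ψ s) - ψ s) :
    Continuous (wavePacket ψ) ∧ ∀ t, HasDerivAt (fun t => R (wavePacket ψ t))
      (z • R (wavePacket ψ t) - wavePacket ψ t) t := by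
  have hi : Integrable ψ := hψ.integrable_of_hasCompactSupport hc
  have hi' : Integrable fun s : ℝ => s • ψ s :=
    (continuous_id.smul hψ).integrable_of_hasCompactSupport hc.smul_left
  have hi'' : Integrable fun s : ℝ => (-2 * Real.pi * Complex.I * s : ℂ) • ψ s :=
    Continuous.integrable_of_hasCompactSupport (by fun_prop) hc.smul_left
  have hd (t : ℝ) := (Real.hasDerivAt_fourier hi hi' (-(2 * Real.pi)⁻¹ * t)).scomp t
    ((hasDerivAt_id t).const_mul (-(2 * Real.pi)⁻¹))
  refine ⟨continuous_iff_continuousAt.2 fun t => (hd t).continuousAt, fun t => ?_⟩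
  have hR := (R.restrictScalars ℝ).hasFDerivAt.comp_hasDerivAt t (hd t)
  convert! hR using 1
  set B : X →L[ℂ] X := (-2 * Real.pi : ℂ) • (z • R - ContinuousLinearMap.id ℂ X)
  have hB : (fun s : ℝ => R ((-2 * Real.pi * Complex.I * s : ℂ) • ψ s)) = fun s => B (ψ s) := by
    ext s
    simp only [B, _root_.smul_apply, _root_.sub_apply,
      ContinuousLinearMap.id_apply]
    rw [← heig s, map_smul, smul_smul]
    ring_nf
  have hpi : (Real.pi : ℂ) ≠ 0 := by exact_mod_cast Real.pi_ne_zero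
  rw [ContinuousLinearMap.map_smul, ContinuousLinearMap.coe_restrictScalars', map_fourier R hi'',
    hB, ← map_fourier B hi, ← Complex.coe_smul]
  simp only [B, _root_.smul_apply, _root_.sub_apply,
    ContinuousLinearMap.id_apply, smul_smul, wavePacket]
  push_cast
  rw [show (-(2 * Real.pi : ℂ)⁻¹ * 1) * (-2 * Real.pi) = 1 by field_simp, one_smul]

/-- The integral of a function with values in a closed subspace belongs to it. -/
theorem integral_mem_of_forall_mem {M : Submodule ℂ X} [CompleteSpace M] [CompleteSpace X]
    {f : ℝ → X} (hf : Continuous f) (hc : HasCompactSupport f) (hM : ∀ s, f s ∈ M) :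
    ∫ s, f s ∈ M := by
  let g : ℝ → M := fun s => ⟨f s, hM s⟩
  have hg : Integrable g := (hf.subtype_mk hM).integrable_of_hasCompactSupport
    (hc.of_isClosed_subset (isClosed_tsupport _) (closure_mono fun s hs h => hs (by simp [h])))
  have h := M.subtypeL.integral_comp_comm hg
  have h' : ∫ s, f s = M.subtypeL (∫ s, g s) := h
  rw [h']
  exact (∫ s, g s).2

/-- The values at interior points of a `C²` field of eigenvectors are limits of initial values of
wave packets. -/
theorem mem_closure_decayingInitialValues_of_mem_interior [CompleteSpace X] {R : X →L[ℂ] X} {z : ℂ}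
    {M : Submodule ℂ X} [CompleteSpace M] {I : Set ℝ} {F : ℝ → X} (hF : ContDiffOn ℝ 2 F I)
    (hM : ∀ s ∈ I, F s ∈ M)
    (heig : ∀ s ∈ I, (Complex.I * (s : ℂ)) • R (F s) = z • R (F s) - F s)
    {t : ℝ} (ht : t ∈ interior I) :
    F t ∈ closure (decayingInitialValues R z M : Set X) := by
  refine Metric.mem_closure_iff.2 fun ε hε => ?_
  have hcont : ContinuousAt F t := (hF.contDiffAt (mem_interior_iff_mem_nhds.1 ht)).continuousAt
  obtain ⟨r, hr, hball⟩ := Metric.nhds_basis_closedBall.mem_iff.1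
    (inter_mem (isOpen_interior.mem_nhds ht)
      (hcont.preimage_mem_nhds (Metric.ball_mem_nhds _ (half_pos hε))))
  let φ : ContDiffBump t := ⟨r / 2, r, half_pos hr, half_lt_self hr⟩
  set ψ : ℝ → X := fun s => φ.normed volume s • F s with hψ
  have hφsupp : tsupport (φ.normed volume) ⊆ Metric.closedBall t r := φ.tsupport_normed_eq.le
  have hsupp : tsupport ψ ⊆ tsupport (φ.normed volume) := tsupport_smul_subset_left _ _
  have hout (s : ℝ) (hs : s ∉ Metric.closedBall t r) : φ.normed volume s = 0 :=
    image_eq_zero_of_notMem_tsupport fun h => hs (hφsupp h)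
  have hsmooth : ContDiff ℝ 2 ψ := by
    refine contDiff_iff_contDiffAt.2 fun s => ?_
    by_cases hs : s ∈ tsupport ψ
    · exact φ.contDiff_normed.contDiffAt.smul
        (hF.contDiffAt (mem_interior_iff_mem_nhds.1 (hball (hφsupp (hsupp hs))).1))
    · exact contDiffAt_const.congr_of_eventuallyEq (notMem_tsupport_iff_eventuallyEq.1 hs)
  have hcs : HasCompactSupport ψ := φ.hasCompactSupport_normed.smul_right
  have hψM (s : ℝ) : ψ s ∈ M := by
    by_cases hs : s ∈ Metric.closedBall t r
    · exact M.smul_of_tower_mem _ (hM s (interior_subset (hball hs).1))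
    · simp [hψ, hout s hs]
  have hψeig (s : ℝ) : (Complex.I * s) • R (ψ s) = z • R (ψ s) - ψ s := by
    by_cases hs : s ∈ Metric.closedBall t r
    · have h := heig s (interior_subset (hball hs).1)
      have hR : R (ψ s) = φ.normed volume s • R (F s) := R.map_smul_of_tower _ _
      rw [hR, smul_comm, h, smul_sub, smul_comm z]
    · simp [hψ, hout s hs]
  obtain ⟨C, hC⟩ := exists_norm_wavePacket_le hsmooth hcs
  obtain ⟨hW, hW'⟩ := hasDerivAt_wavePacket hsmooth.continuous hcs hψeig
  refine ⟨wavePacket ψ 0, ⟨C, wavePacket ψ, ⟨hW, fun τ => ?_, hC, hW'⟩, rfl⟩, ?_⟩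
  · rw [wavePacket, Real.fourier_real_eq_integral_exp_smul]
    exact integral_mem_of_forall_mem
      (by have := hsmooth.continuous; fun_prop) hcs.smul_left fun s => M.smul_mem _ (hψM s)
  · have hφi : Integrable (φ.normed volume) := φ.integrable_normed
    have h1 : F t - wavePacket ψ 0 = ∫ s, φ.normed volume s • (F t - F s) := by
      rw [wavePacket_zero]
      simp only [smul_sub]
      rw [integral_sub (hφi.smul_const _) (integrable_of_contDiff hsmooth hcs),
        integral_smul_const, φ.integral_normed, one_smul]
    rw [dist_eq_norm, h1]
    refine lt_of_le_of_lt (norm_integral_le_of_norm_le (hφi.mul_const (ε / 2))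
      (Eventually.of_forall fun s => ?_)) ?_
    · rw [norm_smul, Real.norm_of_nonneg (φ.nonneg_normed s)]
      by_cases hs : s ∈ Metric.closedBall t r
      · have := (hball hs).2
        refine mul_le_mul_of_nonneg_left ?_ (φ.nonneg_normed s)
        rw [← dist_eq_norm, dist_comm]
        exact (Metric.mem_ball.1 this).le
      · simp [hout s hs]
    · rw [integral_mul_const, φ.integral_normed, one_mul]
      exact half_lt_self hε

theorem mem_closure_decayingInitialValues [CompleteSpace X] {R : X →L[ℂ] X} {z : ℂ}
    {M : Submodule ℂ X} [CompleteSpace M] {I : Set ℝ} (hI : I.OrdConnected)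
    (hI' : (interior I).Nonempty) {F : ℝ → X} (hF : ContDiffOn ℝ 2 F I)
    (hM : ∀ s ∈ I, F s ∈ M)
    (heig : ∀ s ∈ I, (Complex.I * (s : ℂ)) • R (F s) = z • R (F s) - F s) {t : ℝ} (ht : t ∈ I) :
    F t ∈ closure (decayingInitialValues R z M : Set X) := by
  have htc : t ∈ closure (interior I) := by
    rw [(convex_iff_ordConnected.2 hI).closure_interior_eq_closure_of_nonempty_interior hI']
    exact subset_closure ht
  have h := ((hF.continuousOn t ht).mono interior_subset).mem_closure_image htc
  refine closure_minimal ?_ isClosed_closure h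
  rintro _ ⟨s, hs, rfl⟩
  exact mem_closure_decayingInitialValues_of_mem_interior hF hM heig hs

end WavePackets

/-! ### A frequently hypercyclic orbit -/

section Orbit

variable {X : Type*} [NormedAddCommGroup X] [NormedSpace ℂ X] [CompleteSpace X]

/-- If the initial values of decaying orbits are dense in a closed subspace `M`, then `M` contains
a single mild solution which visits every ball of `M` with positive lower density. -/
theorem exists_frequentlyHypercyclic_orbit [TopologicalSpace.SeparableSpace X] {R : X →L[ℂ] X}
    {z : ℂ} {M : Submodule ℂ X} (hMc : IsClosed (M : Set X))
    (hM : (M : Set X) ⊆ closure (decayingInitialValues R z M : Set X)) :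
    ∃ x : ℝ → X, Continuous x ∧ (∀ t, x t ∈ M) ∧
      (∀ t, HasDerivAt (fun t => R (x t)) (z • R (x t) - x t) t) ∧
      ∀ w ∈ M, ∀ ε > 0, PositiveLowerDensity {t | 0 ≤ t ∧ ‖x t - w‖ < ε} := by
  obtain ⟨v, hv⟩ := TopologicalSpace.exists_dense_seq (decayingInitialValues R z M)
  choose c g hg hg0 using fun i => (v i).2
  -- The enumeration of the orbits in which every orbit recurs infinitely often, and the `k`-th
  -- one decays with the constant `k + 1`.
  let G : ℕ → ℝ → X := fun k => if c k.unpair.1 ≤ k + 1 then g k.unpair.1 else fun _ => 0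
  have hG (k : ℕ) : IsDecayingOrbit R z M (k + 1) (G k) := by
    by_cases h : c k.unpair.1 ≤ k + 1
    · simpa only [G, if_pos h] using (hg _).mono h
    · simpa only [G, if_neg h] using IsDecayingOrbit.zero.mono (by positivity)
  have hb (k : ℕ) (t : ℝ) : ‖G k t‖ ≤ (k + 1) / (1 + t ^ 2) := (hG k).bound t
  have hs := summable_translate hb
  have hcont := continuous_visitSum hb fun k => (hG k).continuous
  have hmem (t : ℝ) : visitSum G t ∈ M :=
    hMc.mem_of_tendsto (hs t).hasSum (Eventually.of_forall fun s =>
      M.sum_mem fun m _ => (hG _).mem _)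
  refine ⟨visitSum G, hcont, hmem, fun t => ?_, fun w hw ε hε => ?_⟩
  · have h := hasDerivAt_visitSum (H := fun k t => R (G k t))
      (H' := fun k t => z • R (G k t) - G k t) (c := ‖z • R - ContinuousLinearMap.id ℂ X‖)
      (fun t => R.summable (hs t)) (fun k t => ?_) (fun k t => (hG k).hasDerivAt t) t
    · have h1 (t : ℝ) : visitSum (fun k t => R (G k t)) t = R (visitSum G t) :=
        (R.map_tsum (hs t)).symm
      have h2 : visitSum (fun k t => z • R (G k t) - G k t) t =
          z • R (visitSum G t) - visitSum G t :=
        ((z • R - ContinuousLinearMap.id ℂ X).map_tsum (hs t)).symm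
      rw [h2] at h
      exact h.congr_of_eventuallyEq (Eventually.of_forall fun t => (h1 t).symm)
    · exact ((z • R - ContinuousLinearMap.id ℂ X).le_opNorm (G k t)).trans
        (mul_le_mul_of_nonneg_left (hb k t) (norm_nonneg _))
  · obtain ⟨C, hC⟩ := exists_norm_visitSum_sub_le (X := X)
    have hε3 : 0 < ε / 3 := by positivity
    obtain ⟨y, hy, hyw⟩ := Metric.mem_closure_iff.1 (hM hw) (ε / 6) (by positivity)
    obtain ⟨i, hi⟩ := hv.exists_mem_open (Metric.isOpen_ball (x := ⟨y, hy⟩) (ε := ε / 6))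
      ⟨_, Metric.mem_ball_self (by positivity)⟩
    have hiw : ‖g i 0 - w‖ < ε / 3 := by
      rw [hg0, ← dist_eq_norm]
      have h1 : dist (v i : X) y < ε / 6 := hi
      rw [dist_comm] at hyw
      linarith [dist_triangle (v i : X) y w]
    obtain ⟨δ, hδ, hδε⟩ := Metric.continuousAt_iff.1 (hg i).continuous.continuousAt (ε / 3) hε3
    obtain ⟨b, hb'⟩ := exists_nat_gt (max (c i) (C / (ε / 3)))
    set k := Nat.pair i b
    have hbk : (b : ℝ) ≤ k := by exact_mod_cast Nat.right_le_pair i b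
    have hGk : G k = g i := by
      have h1 : c k.unpair.1 ≤ k + 1 := by
        rw [Nat.unpair_pair]
        exact ((le_max_left _ _).trans hb'.le).trans (by linarith)
      simp only [G, if_pos h1]
      rw [Nat.unpair_pair]
    have hCk : C / (k + 1) < ε / 3 := by
      have h1 := (le_max_right _ _).trans_lt hb'
      rw [div_lt_iff₀ hε3] at h1
      rw [div_lt_iff₀ (by positivity)]
      nlinarith
    refine positiveLowerDensity_of_visits k (δ := min (δ / 2) 1) (by positivity) (min_le_right _ _)
      fun m hm t ht => ?_
    have ht0 : 0 ≤ t - visitTime m := by linarith [ht.1]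
    have ht1 : t - visitTime m ≤ min (δ / 2) 1 := by linarith [ht.2]
    have h1 := hC G hb m (t - visitTime m) ⟨ht0, ht1.trans (min_le_right _ _)⟩
    rw [hm, hGk, add_sub_cancel] at h1
    have h2 : dist (g i (t - visitTime m)) (g i 0) < ε / 3 := hδε (by
      rw [Real.dist_eq, sub_zero, abs_of_nonneg ht0]
      linarith [ht1.trans (min_le_left _ _)])
    rw [dist_eq_norm] at h2
    refine ⟨by linarith [succ_le_visitTime m, Nat.cast_nonneg (α := ℝ) m], ?_⟩
    calc ‖visitSum G t - w‖ = ‖(visitSum G t - g i (t - visitTime m)) +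
          (g i (t - visitTime m) - g i 0) + (g i 0 - w)‖ := by congr 1; abel
      _ ≤ _ := norm_add₃_le
      _ < ε := by linarith

end Orbit

/-! ### Powers of an operator and powers of its resolvent -/

section Chains

variable {X : Type*} [NormedAddCommGroup X] [NormedSpace ℂ X]

namespace IsResolventAt

variable {T : X →ₗ.[ℂ] X} {z : ℂ} {R : X →L[ℂ] X}

theorem mem_domain (hR : IsResolventAt T z R) (x : X) : R x ∈ T.domain := (hR.right_inv x).1

theorem apply_eq (hR : IsResolventAt T z R) (x : X) :
    T ⟨R x, hR.mem_domain x⟩ = z • R x - x :=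
  eq_sub_of_add_eq' (sub_eq_iff_eq_add.1 (hR.right_inv x).2).symm

theorem smul_eq_of_eigenvector (hR : IsResolventAt T z R) {x : X} {μ : ℂ} (hx : x ∈ T.domain)
    (hμ : T ⟨x, hx⟩ = μ • x) : μ • R x = z • R x - x := by
  have h := hR.left_inv ⟨x, hx⟩
  rw [hμ, map_sub, map_smul, map_smul] at h
  exact eq_sub_of_add_eq' (sub_eq_iff_eq_add.1 h).symm

end IsResolventAt

/-- The finite sequence `a 0, …, a k` consists of the iterates of `a 0` under `T`. -/
def IsChain (T : X →ₗ.[ℂ] X) (k : ℕ) (a : ℕ → X) : Prop :=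
  ∀ i < k, ∃ h : a i ∈ T.domain, T ⟨a i, h⟩ = a (i + 1)

theorem IsChain.mono {T : X →ₗ.[ℂ] X} {k l : ℕ} {a : ℕ → X} (h : IsChain T k a) (hl : l ≤ k) :
    IsChain T l a := fun i hi => h i (hi.trans_le hl)

theorem IsChain.powOp_eq {T : X →ₗ.[ℂ] X} {k : ℕ} {a : ℕ → X} (h : IsChain T k a) :
    ∃ h0 : a 0 ∈ (powOp T k).domain, powOp T k ⟨a 0, h0⟩ = a k := by
  induction k with
  | zero => exact ⟨Submodule.mem_top, rfl⟩
  | succ k ih =>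
    obtain ⟨h0, h1⟩ := ih (h.mono k.le_succ)
    obtain ⟨h2, h3⟩ := h k k.lt_succ_self
    have h4 : powOp T k ⟨a 0, h0⟩ ∈ T.domain := h1 ▸ h2
    refine ⟨(mem_mulDomain T (powOp T k) _).2 ⟨h0, h4⟩, ?_⟩
    rw [← h3]
    have h5 : (⟨powOp T k ⟨a 0, h0⟩, h4⟩ : T.domain) = ⟨a k, h2⟩ := Subtype.ext h1
    exact congrArg T h5

/-- The iterates of `x ∈ D(T ^ k)` under `T`, continued by `0`. -/
def powSeq (T : X →ₗ.[ℂ] X) (k : ℕ) (x : (powOp T k).domain) (i : ℕ) : X :=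
  if h : i ≤ k then powOp T i ⟨x, powOp_domain_antitone T h x.2⟩ else 0

theorem powSeq_zero (T : X →ₗ.[ℂ] X) (k : ℕ) (x : (powOp T k).domain) :
    powSeq T k x 0 = x := by
  rw [powSeq, dif_pos k.zero_le]
  rfl

theorem powSeq_sub (T : X →ₗ.[ℂ] X) (k : ℕ) (x y : (powOp T k).domain) (i : ℕ) :
    powSeq T k (x - y) i = powSeq T k x i - powSeq T k y i := by
  unfold powSeq
  split_ifs with h
  · exact (powOp T i).map_sub ⟨x, powOp_domain_antitone T h x.2⟩
      ⟨y, powOp_domain_antitone T h y.2⟩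
  · simp

theorem isChain_powSeq (T : X →ₗ.[ℂ] X) (k : ℕ) (x : (powOp T k).domain) :
    IsChain T k (powSeq T k x) := by
  intro i hi
  have h1 : (x : X) ∈ (powOp T (i + 1)).domain := powOp_domain_antitone T (Nat.succ_le_of_lt hi) x.2
  have h2 := ((mem_mulDomain T (powOp T i) x).1 h1).2
  simp only [powSeq, dif_pos hi.le, dif_pos (Nat.succ_le_of_lt hi)]
  exact ⟨h2, rfl⟩

theorem graphNorm_eq (T : X →ₗ.[ℂ] X) (k : ℕ) (x : (powOp T k).domain) :
    graphNorm T k x = ∑ i : Fin (k + 1), ‖powSeq T k x i‖ := by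
  have h (s : Finset (Fin (k + 1))) (p : Fin (k + 1) → Seminorm ℂ (powOp T k).domain) :
      (∑ i ∈ s, p i) x = ∑ i ∈ s, p i x := by
    classical
    induction s using Finset.induction_on with
    | empty => simp
    | insert a s ha ih => rw [Finset.sum_insert ha, Finset.sum_insert ha, _root_.add_apply, ih]
  rw [graphNorm, h]
  refine Finset.sum_congr rfl fun i _ => ?_
  rw [powSeq, dif_pos i.is_le]
  rfl

theorem norm_powSeq_le (T : X →ₗ.[ℂ] X) (k : ℕ) (x : (powOp T k).domain) (i : ℕ) :
    ‖powSeq T k x i‖ ≤ graphNorm T k x := by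
  by_cases h : i ≤ k
  · rw [graphNorm_eq]
    exact Finset.single_le_sum (f := fun i : Fin (k + 1) => ‖powSeq T k x i‖)
      (fun _ _ => norm_nonneg _) (Finset.mem_univ ⟨i, Nat.lt_succ_of_le h⟩)
  · rw [powSeq, dif_neg h, norm_zero]
    exact apply_nonneg _ _

/-- The action of `z - T` on chains. -/
def chainDiff (z : ℂ) : (ℕ → X) →ₗ[ℂ] (ℕ → X) where
  toFun a i := z • a i - a (i + 1)
  map_add' a b := by
    ext i
    simp only [Pi.add_apply, smul_add]
    abel
  map_smul' c a := by
    ext i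
    simp only [Pi.smul_apply, RingHom.id_apply, smul_sub, smul_comm c z]

theorem IsChain.chainDiff {T : X →ₗ.[ℂ] X} {k : ℕ} {a : ℕ → X} (h : IsChain T (k + 1) a) (z : ℂ) :
    IsChain T k (chainDiff z a) := by
  intro i hi
  obtain ⟨h1, h2⟩ := h i (by omega)
  obtain ⟨h3, h4⟩ := h (i + 1) (by omega)
  refine ⟨T.domain.sub_mem (T.domain.smul_mem z h1) h3, ?_⟩
  have h5 := T.map_sub (z • ⟨a i, h1⟩) ⟨a (i + 1), h3⟩
  rw [T.map_smul, h2, h4] at h5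
  exact h5

/-- `x = R ^ k (z - T) ^ k x` for `x ∈ D(T ^ k)`. -/
theorem IsChain.eq_pow_resolvent {T : X →ₗ.[ℂ] X} {z : ℂ} {R : X →L[ℂ] X}
    (hR : IsResolventAt T z R) {k : ℕ} {a : ℕ → X} (h : IsChain T k a) :
    a 0 = (R ^ k) (((ACP.chainDiff z)^[k] a) 0) := by
  induction k generalizing a with
  | zero => rfl
  | succ k ih =>
    obtain ⟨h1, h2⟩ := h 0 k.succ_pos
    have h3 := hR.left_inv ⟨a 0, h1⟩
    rw [h2] at h3
    rw [Function.iterate_succ_apply, pow_succ', mul_apply_eq_comp, ← ih (h.chainDiff z)]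
    exact h3.symm

theorem norm_iterate_chainDiff_le (z : ℂ) (k : ℕ) {a : ℕ → X} {C : ℝ} (h : ∀ i, ‖a i‖ ≤ C)
    (i : ℕ) : ‖((chainDiff z)^[k] a) i‖ ≤ (‖z‖ + 1) ^ k * C := by
  induction k generalizing i with
  | zero => simpa using h i
  | succ k ih =>
    rw [Function.iterate_succ_apply', pow_succ']
    calc ‖z • ((chainDiff z)^[k] a) i - ((chainDiff z)^[k] a) (i + 1)‖
        ≤ ‖z‖ * ((‖z‖ + 1) ^ k * C) + (‖z‖ + 1) ^ k * C := by
          refine (norm_sub_le _ _).trans (add_le_add ?_ (ih _))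
          rw [norm_smul]
          exact mul_le_mul_of_nonneg_left (ih _) (norm_nonneg _)
      _ = _ := by ring

theorem iterate_chainDiff_sub (z : ℂ) (k : ℕ) (a b : ℕ → X) :
    (chainDiff z)^[k] (a - b) = (chainDiff z)^[k] a - (chainDiff z)^[k] b := by
  simp only [← Module.End.pow_apply, map_sub]

theorem iterate_chainDiff_mem (z : ℂ) (k : ℕ) {S : Submodule ℂ X} {a : ℕ → X} (h : ∀ i, a i ∈ S)
    (i : ℕ) : ((chainDiff z)^[k] a) i ∈ S := by
  induction k generalizing i with
  | zero => exact h i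
  | succ k ih =>
    rw [Function.iterate_succ_apply']
    exact S.sub_mem (S.smul_mem z (ih i)) (ih (i + 1))

/-- The bounded operator `T ^ i R ^ n`, for `i ≤ n`. -/
def powResolvent (R : X →L[ℂ] X) (z : ℂ) (n i : ℕ) : X →L[ℂ] X :=
  R ^ (n - i) * (z • R - 1) ^ i

theorem powResolvent_zero (R : X →L[ℂ] X) (z : ℂ) (n : ℕ) : powResolvent R z n 0 = R ^ n := by
  simp [powResolvent]

theorem powResolvent_of_lt (R : X →L[ℂ] X) (z : ℂ) {n i : ℕ} (hi : i < n) (x : X) :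
    powResolvent R z n i x = (R ^ (n - (i + 1)) * (z • R - 1) ^ i) (R x) := by
  have h1 : n - i = n - (i + 1) + 1 := by omega
  have h2 : Commute ((z • R - 1) ^ i) R :=
    (((Commute.refl R).smul_left z).sub_left (Commute.one_left R)).pow_left i
  rw [powResolvent, h1, pow_succ, mul_assoc, ← h2.eq, ← mul_assoc]
  rfl

theorem powResolvent_succ (R : X →L[ℂ] X) (z : ℂ) (n i : ℕ) (x : X) :
    powResolvent R z n (i + 1) x =
      (R ^ (n - (i + 1)) * (z • R - 1) ^ i) (z • R x - x) := by
  rw [powResolvent, pow_succ, ← mul_assoc]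
  rfl

theorem isChain_powResolvent {T : X →ₗ.[ℂ] X} {z : ℂ} {R : X →L[ℂ] X} (hR : IsResolventAt T z R)
    (n : ℕ) (x : X) : IsChain T n fun i => powResolvent R z n i x := by
  intro i hi
  set B := R ^ (n - (i + 1)) * (z • R - 1) ^ i
  have hB : Commute B R :=
    ((Commute.refl R).pow_left _).mul_left
      ((((Commute.refl R).smul_left z).sub_left (Commute.one_left R)).pow_left i)
  have h1 : powResolvent R z n i x = R (B x) := by
    rw [powResolvent_of_lt R z hi]
    exact DFunLike.congr_fun hB.eq x
  have h2 : powResolvent R z n (i + 1) x = z • R (B x) - B x := by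
    rw [powResolvent_succ, map_sub, map_smul]
    exact congrArg (fun y => z • y - B x) (DFunLike.congr_fun hB.eq x)
  refine ⟨(congrArg (· ∈ T.domain) h1).mpr (hR.mem_domain (B x)), ?_⟩
  change T ⟨powResolvent R z n i x, _⟩ = powResolvent R z n (i + 1) x
  rw [h2, ← hR.apply_eq]
  exact congrArg T (Subtype.ext h1)

theorem powSeq_eq_of_isChain {T : X →ₗ.[ℂ] X} {k : ℕ} {a : ℕ → X} (h : IsChain T k a)
    (h0 : a 0 ∈ (powOp T k).domain) {i : ℕ} (hi : i ≤ k) : powSeq T k ⟨a 0, h0⟩ i = a i := by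
  obtain ⟨_, h1⟩ := (h.mono hi).powOp_eq
  rw [powSeq, dif_pos hi, ← h1]

/-- If `S` is spanned by eigenvectors of `T`, then the closure of `S` in `[D(T ^ n)]` is the image
under `(z - T)⁻ⁿ` of the closure of `S` in `X`: the operator `(z - T)ⁿ` is an isomorphism of
`[D(T ^ n)]` onto `X`, and both it and its inverse leave `S` invariant. -/
theorem mem_graphClosure_span_iff {T : X →ₗ.[ℂ] X} {z : ℂ} {R : X →L[ℂ] X}
    (hR : IsResolventAt T z R) (n : ℕ) {s : Set X}
    (hs : ∀ x ∈ s, ∃ (μ : ℂ) (h : x ∈ T.domain), T ⟨x, h⟩ = μ • x) (v : X) :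
    v ∈ graphClosure T n (Submodule.span ℂ s) ↔
      ∃ w ∈ (Submodule.span ℂ s).topologicalClosure, (R ^ n) w = v := by
  set S := Submodule.span ℂ s
  have hRS (x : X) (hx : x ∈ S) : R x ∈ S := by
    induction hx using Submodule.span_induction with
    | mem x hx =>
      obtain ⟨μ, h, hμ⟩ := hs x hx
      have h1 := hR.smul_eq_of_eigenvector h hμ
      by_cases hz : z = μ
      · have h2 : x = 0 := by rwa [hz, eq_comm, sub_eq_self] at h1
        simp [h2]
      · have h2 : (z - μ) • R x = x := by rw [sub_smul, h1, sub_sub_cancel]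
        rw [← inv_smul_smul₀ (sub_ne_zero.2 hz) (R x), h2]
        exact S.smul_mem _ (Submodule.subset_span hx)
    | zero => simp
    | add x y _ _ hx hy => rw [map_add]; exact S.add_mem hx hy
    | smul c x _ hx => rw [map_smul]; exact S.smul_mem c hx
  have hRnS (k : ℕ) (x : X) (hx : x ∈ S) : (R ^ k) x ∈ S := by
    induction k with
    | zero => exact hx
    | succ k ih => rw [pow_succ']; exact hRS _ ih
  have hTS (x : X) (hx : x ∈ S) : ∃ h : x ∈ T.domain, T ⟨x, h⟩ ∈ S := by
    induction hx using Submodule.span_induction with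
    | mem x hx =>
      obtain ⟨μ, h, hμ⟩ := hs x hx
      exact ⟨h, hμ ▸ S.smul_mem _ (Submodule.subset_span hx)⟩
    | zero => exact ⟨T.domain.zero_mem, by
      rw [show (⟨0, _⟩ : T.domain) = 0 from rfl, T.map_zero]; exact S.zero_mem⟩
    | add x y _ _ hx hy =>
      obtain ⟨h1, h2⟩ := hx
      obtain ⟨h3, h4⟩ := hy
      refine ⟨T.domain.add_mem h1 h3, ?_⟩
      have h := T.map_add ⟨x, h1⟩ ⟨y, h3⟩
      exact (show T ⟨x + y, _⟩ = _ from h) ▸ S.add_mem h2 h4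
    | smul c x _ hx =>
      obtain ⟨h1, h2⟩ := hx
      refine ⟨T.domain.smul_mem c h1, ?_⟩
      have h := T.map_smul c ⟨x, h1⟩
      exact (show T ⟨c • x, _⟩ = _ from h) ▸ S.smul_mem c h2
  have hpow (y : (powOp T n).domain) (hy : (y : X) ∈ S) (i : ℕ) : powSeq T n y i ∈ S := by
    induction i with
    | zero => rwa [powSeq_zero]
    | succ i ih =>
      by_cases hi : i < n
      · obtain ⟨h1, h2⟩ := isChain_powSeq T n y i hi
        rw [← h2]
        exact (hTS _ ih).2
      · rw [powSeq, dif_neg (by omega)]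
        exact S.zero_mem
  constructor
  · rintro ⟨v, hv, rfl⟩
    refine ⟨((chainDiff z)^[n] (powSeq T n v)) 0, Metric.mem_closure_iff.2 fun ε hε => ?_, ?_⟩
    · obtain ⟨y, hy, hyv⟩ := hv (ε / (‖z‖ + 1) ^ n) (by positivity)
      refine ⟨((chainDiff z)^[n] (powSeq T n y)) 0, iterate_chainDiff_mem z n (hpow y hy) 0, ?_⟩
      have h1 : powSeq T n (v - y) = powSeq T n v - powSeq T n y := funext (powSeq_sub T n v y)
      rw [dist_eq_norm, ← Pi.sub_apply, ← iterate_chainDiff_sub, ← h1]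
      refine (norm_iterate_chainDiff_le z n (norm_powSeq_le T n _) 0).trans_lt ?_
      rwa [lt_div_iff₀' (by positivity)] at hyv
    · rw [← (isChain_powSeq T n v).eq_pow_resolvent hR, powSeq_zero]
      rfl
  · rintro ⟨w, hw, rfl⟩
    have hdom (x : X) : ∃ h : (R ^ n) x ∈ (powOp T n).domain,
        ∀ i ≤ n, powSeq T n ⟨(R ^ n) x, h⟩ i = powResolvent R z n i x := by
      have hc := isChain_powResolvent hR n x
      obtain ⟨h1, -⟩ := hc.powOp_eq
      have h2 : powResolvent R z n 0 x = (R ^ n) x := by rw [powResolvent_zero]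
      refine ⟨h2 ▸ h1, fun i hi => ?_⟩
      have h3 := powSeq_eq_of_isChain hc h1 hi
      rw [← h3]
      congr 2
    obtain ⟨hwd, -⟩ := hdom w
    refine ⟨⟨(R ^ n) w, hwd⟩, fun ε hε => ?_, rfl⟩
    set C := ∑ i : Fin (n + 1), ‖powResolvent R z n i‖
    have hC : 0 ≤ C := Finset.sum_nonneg fun _ _ => norm_nonneg _
    obtain ⟨y, hy, hwy⟩ := Metric.mem_closure_iff.1 hw (ε / (C + 1)) (by positivity)
    obtain ⟨hyd, -⟩ := hdom y
    obtain ⟨hd, hpd⟩ := hdom (w - y)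
    refine ⟨⟨(R ^ n) y, hyd⟩, hRnS n y hy, ?_⟩
    have h1 : (⟨(R ^ n) w, hwd⟩ - ⟨(R ^ n) y, hyd⟩ : (powOp T n).domain) =
        ⟨(R ^ n) (w - y), hd⟩ := Subtype.ext (map_sub (R ^ n) w y).symm
    rw [h1, graphNorm_eq]
    calc ∑ i : Fin (n + 1), ‖powSeq T n ⟨(R ^ n) (w - y), hd⟩ i‖
        ≤ ∑ i : Fin (n + 1), ‖powResolvent R z n i‖ * ‖w - y‖ := by
          refine Finset.sum_le_sum fun i _ => ?_
          rw [hpd i i.is_le]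
          exact ContinuousLinearMap.le_opNorm _ _
      _ = C * ‖w - y‖ := by rw [Finset.sum_mul]
      _ ≤ (C + 1) * ‖w - y‖ := by gcongr; linarith
      _ < ε := by
        rw [dist_eq_norm, lt_div_iff₀' (by positivity)] at hwy
        exact hwy

end Chains

/-! ### Resolvents of generators -/

section Generator

variable {E : Type*} [NormedAddCommGroup E] [NormedSpace ℂ E]

namespace IsC0Semigroup

variable {S : ℝ → E →L[ℂ] E}

theorem continuous_max (hS : IsC0Semigroup S) (x : E) : Continuous fun t => S (max t 0) x :=
  (hS.cont x).comp_continuous (by fun_prop) fun t => le_max_right t 0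

theorem comm (hS : IsC0Semigroup S) {s t : ℝ} (hs : 0 ≤ s) (ht : 0 ≤ t) (x : E) :
    S s (S t x) = S t (S s x) := by
  have h := hS.add s t hs ht
  rw [add_comm, hS.add t s ht hs] at h
  exact (DFunLike.congr_fun h x).symm

variable [CompleteSpace E]

theorem exists_norm_le (hS : IsC0Semigroup S) : ∃ M, 0 < M ∧ ∀ t ∈ Icc (0 : ℝ) 1, ‖S t‖ ≤ M := by
  obtain ⟨C, hC⟩ := banach_steinhaus (g := fun t : Icc (0 : ℝ) 1 => S t) fun x => by
    obtain ⟨C, hC⟩ := isCompact_Icc.exists_bound_of_continuousOn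
      ((hS.cont x).mono fun t (ht : t ∈ Icc (0 : ℝ) 1) => ht.1)
    exact ⟨C, fun t => hC t t.2⟩
  exact ⟨max C 1, by positivity, fun t ht => (hC ⟨t, ht⟩).trans (le_max_left _ _)⟩

end IsC0Semigroup

/-- The integrand `exp (-z t) S(t) x` of the Laplace transform, extended to all real times. -/
def laplaceIntegrand (S : ℝ → E →L[ℂ] E) (z : ℝ) (x : E) (t : ℝ) : E :=
  Real.exp (-z * t) • S (max t 0) x

theorem continuous_laplaceIntegrand {S : ℝ → E →L[ℂ] E} (hS : IsC0Semigroup S) (z : ℝ) (x : E) :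
    Continuous (laplaceIntegrand S z x) := by
  have h : Continuous fun t : ℝ => Real.exp (-z * t) := by fun_prop
  exact h.smul (hS.continuous_max x)

variable [CompleteSpace E]

/-- For a strongly continuous semigroup with generator `B` and large `z > 0`, the operator
`Q x = ∫_0^1 exp (-z t) S(t) x dt` satisfies `(z - B) Q = 1 - exp (-z) S(1)` and commutes with `B`,
so that `Q (1 - exp (-z) S(1))⁻¹` is the resolvent of `B` at `z`. Integrating over a finite interval
only makes bounds on the growth of the semigroup unnecessary. -/
theorem exists_laplace {B : E →ₗ.[ℂ] E} {S : ℝ → E →L[ℂ] E} (hS : IsC0Semigroup S)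
    (hB : IsGeneratorOf B S) {M : ℝ} (hM : 0 < M) (hSM : ∀ t ∈ Icc (0 : ℝ) 1, ‖S t‖ ≤ M) {z : ℝ}
    (hz : 0 < z) :
    ∃ Q : E →L[ℂ] E, ‖Q‖ ≤ M / z ∧ (∀ t, 0 ≤ t → ∀ x, S t (Q x) = Q (S t x)) ∧
      (∀ x, (Q x, (z : ℂ) • Q x - (x - (Real.exp (-z) : ℂ) • S 1 x)) ∈ B.graph) ∧
      ∀ x : B.domain, Q ((z : ℂ) • (x : E) - B x) = x - (Real.exp (-z) : ℂ) • S 1 x := by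
  have hint (x : E) (a b : ℝ) : IntervalIntegrable (laplaceIntegrand S z x) volume a b :=
    (continuous_laplaceIntegrand hS z x).intervalIntegrable a b
  let Q₀ : E →ₗ[ℂ] E :=
    { toFun := fun x => ∫ t in (0 : ℝ)..1, laplaceIntegrand S z x t
      map_add' := fun x y => by
        rw [← intervalIntegral.integral_add (hint x 0 1) (hint y 0 1)]
        simp [laplaceIntegrand]
      map_smul' := fun c x => by
        rw [RingHom.id_apply, ← intervalIntegral.integral_smul]
        simp [laplaceIntegrand, smul_comm c] }
  have hbound (x : E) : ‖Q₀ x‖ ≤ M / z * ‖x‖ := by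
    have h1 : ‖Q₀ x‖ ≤ ∫ t in (0 : ℝ)..1, Real.exp (-z * t) * (M * ‖x‖) := by
      refine intervalIntegral.norm_integral_le_of_norm_le zero_le_one
        (Eventually.of_forall fun t ht => ?_) (Continuous.intervalIntegrable (by fun_prop) _ _)
      rw [laplaceIntegrand, norm_smul, Real.norm_of_nonneg (Real.exp_pos _).le, max_eq_left ht.1.le]
      gcongr
      exact (S t).le_of_opNorm_le (hSM t ⟨ht.1.le, ht.2⟩) x
    refine h1.trans ?_
    have h2 : ∫ t in (0 : ℝ)..1, Real.exp (-z * t) = (1 - Real.exp (-z)) / z := by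
      rw [intervalIntegral.integral_comp_mul_left Real.exp (neg_ne_zero.2 hz.ne')]
      simp
      field_simp
      ring
    rw [intervalIntegral.integral_mul_const, h2, div_mul_eq_mul_div, div_mul_eq_mul_div]
    have h3 : 0 ≤ M * ‖x‖ := by positivity
    refine div_le_div_of_nonneg_right ?_ hz.le
    nlinarith [Real.exp_pos (-z)]
  let Q : E →L[ℂ] E := Q₀.mkContinuous (M / z) hbound
  have hQ (x : E) : Q x = ∫ t in (0 : ℝ)..1, laplaceIntegrand S z x t := rfl
  have hcomm (h : ℝ) (hh : 0 ≤ h) (x : E) : S h (Q x) = Q (S h x) := by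
    rw [hQ, hQ, ← (S h).intervalIntegral_comp_comm (hint x 0 1)]
    refine intervalIntegral.integral_congr fun t _ => ?_
    simp only [laplaceIntegrand]
    rw [ContinuousLinearMap.map_smul_of_tower, hS.comm hh (le_max_right _ _)]
  have hgraph (x : E) :
      (Q x, (z : ℂ) • Q x - (x - (Real.exp (-z) : ℂ) • S 1 x)) ∈ B.graph := by
    refine (hB _ _).2 ?_
    let Φ : ℝ → E := fun h => ∫ t in (0 : ℝ)..h, laplaceIntegrand S z x t
    have hΦ (h : ℝ) : HasDerivAt Φ (laplaceIntegrand S z x h) h :=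
      (continuous_laplaceIntegrand hS z x).integral_hasStrictDerivAt 0 h |>.hasDerivAt
    let f : ℝ → E := fun h => Real.exp (z * h) • (Φ (1 + h) - Φ h)
    have hf : HasDerivAt f ((z : ℂ) • Q x - (x - (Real.exp (-z) : ℂ) • S 1 x)) 0 := by
      have h1 : HasDerivAt (fun h : ℝ => Real.exp (z * h)) z 0 := by
        simpa using ((hasDerivAt_id (0 : ℝ)).const_mul z).exp
      have h2 : HasDerivAt (fun h => Φ (1 + h)) (laplaceIntegrand S z x 1) 0 := by
        have := hΦ (1 + 0)
        rw [add_zero] at this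
        exact HasDerivAt.comp_const_add 1 0 (by simpa using this)
      have h3 := h1.smul (h2.sub (hΦ 0))
      convert! h3 using 1
      simp [laplaceIntegrand, Φ, hS.zero, hQ]
      rw [← Complex.ofReal_neg, ← Complex.ofReal_exp, Complex.coe_smul]
      abel
    have hf' : ∀ h : ℝ, 0 ≤ h → S h (Q x) = f h := fun h hh => by
      have h1 : f h = Real.exp (z * h) • ∫ t in h..(1 + h), laplaceIntegrand S z x t := by
        simp only [f, Φ]
        rw [intervalIntegral.integral_interval_sub_left (hint x _ _) (hint x _ _)]
      have h2 : ∫ t in h..(1 + h), laplaceIntegrand S z x t =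
          ∫ t in (0 : ℝ)..1, laplaceIntegrand S z x (t + h) := by
        rw [intervalIntegral.integral_comp_add_right, zero_add]
      rw [h1, h2, hQ, ← (S h).intervalIntegral_comp_comm (hint x 0 1),
        ← intervalIntegral.integral_smul]
      refine intervalIntegral.integral_congr fun t ht => ?_
      rw [uIcc_of_le zero_le_one] at ht
      simp only [laplaceIntegrand]
      rw [max_eq_left ht.1, max_eq_left (add_nonneg ht.1 hh), smul_smul, ← Real.exp_add,
        ContinuousLinearMap.map_smul_of_tower, add_comm t h, hS.add h t hh ht.1]
      congr 2
      ring
    have h1 := hf.tendsto_slope_zero_right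
    refine h1.congr' ?_
    filter_upwards [self_mem_nhdsWithin] with h (hh : 0 < h)
    rw [zero_add, hf' h hh.le, ← hf' 0 le_rfl, hS.zero, ContinuousLinearMap.id_apply]
  refine ⟨Q, Q₀.mkContinuous_norm_le (by positivity) hbound, hcomm, hgraph, fun x => ?_⟩
  -- `B Q x = Q B x`, since `Q` commutes with the semigroup
  have h1 := ((hB x (B x)).1 (LinearPMap.mem_graph B x))
  have h2 : Tendsto (fun h : ℝ => h⁻¹ • (S h (Q x) - Q x)) (𝓝[>] 0) (𝓝 (Q (B x))) := by
    refine ((Q.continuous.tendsto _).comp h1).congr' ?_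
    filter_upwards [self_mem_nhdsWithin] with h (hh : 0 < h)
    rw [Function.comp_apply, ContinuousLinearMap.map_smul_of_tower, map_sub, hcomm h hh.le]
  have h3 := tendsto_nhds_unique h2 ((hB _ _).1 (hgraph x))
  rw [map_sub, map_smul, h3, sub_sub_cancel]

/-- Existence of the resolvent of a generator at large real points, with the resolvent estimate
of Hille and Yosida. -/
theorem exists_resolvent_of_generator {B : E →ₗ.[ℂ] E} (hB : GeneratesC0Semigroup B) :
    ∃ M : ℝ, 0 < M ∧ ∃ z₀ : ℝ, 0 < z₀ ∧ ∀ z : ℝ, z₀ ≤ z →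
      ∃ R : E →L[ℂ] E, IsResolventAt B z R ∧ ‖R‖ ≤ M / z := by
  obtain ⟨S, hS, hB⟩ := hB
  obtain ⟨M, hM, hSM⟩ := hS.exists_norm_le
  refine ⟨2 * M, by positivity, 2 * M, by positivity, fun z hz => ?_⟩
  have hz0 : 0 < z := by linarith
  obtain ⟨Q, hQ, hcomm, hgraph, hleft⟩ := exists_laplace hS hB hM hSM hz0
  set K : E →L[ℂ] E := (Real.exp (-z) : ℂ) • S 1 with hKdef
  have hK : ‖K‖ ≤ 1 / 2 := by
    rw [hKdef, norm_smul, Complex.norm_real, Real.norm_of_nonneg (Real.exp_pos _).le]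
    have h1 : ‖S 1‖ ≤ M := hSM 1 ⟨zero_le_one, le_rfl⟩
    have h2 : Real.exp (-z) ≤ 1 / z := by
      rw [Real.exp_neg, ← one_div]
      exact one_div_le_one_div_of_le hz0 (by linarith [Real.add_one_le_exp z])
    calc Real.exp (-z) * ‖S 1‖ ≤ 1 / z * M := by gcongr
      _ ≤ 1 / 2 := by
        rw [one_div_mul_eq_div, div_le_iff₀ hz0]
        linarith
  obtain ⟨u, hu⟩ := isUnit_one_sub_of_norm_lt_one (hK.trans_lt one_half_lt_one)
  have hu1 (x : E) : (u : E →L[ℂ] E) ((↑u⁻¹ : E →L[ℂ] E) x) = x :=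
    DFunLike.congr_fun u.mul_inv x
  have hu2 (x : E) : (↑u⁻¹ : E →L[ℂ] E) ((u : E →L[ℂ] E) x) = x :=
    DFunLike.congr_fun u.inv_mul x
  have huK (x : E) : (u : E →L[ℂ] E) x = x - (Real.exp (-z) : ℂ) • S 1 x := by
    rw [hu]
    rfl
  have hQu (x : E) : (u : E →L[ℂ] E) (Q x) = Q ((u : E →L[ℂ] E) x) := by
    rw [huK, huK, map_sub, map_smul, hcomm 1 zero_le_one]
  refine ⟨Q * ↑u⁻¹, ⟨fun x => ?_, fun x => ?_⟩, ?_⟩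
  · obtain ⟨⟨y, hy⟩, h1, h2⟩ := (LinearPMap.mem_graph_iff B).1 (hgraph ((↑u⁻¹ : E →L[ℂ] E) x))
    subst h1
    refine ⟨hy, ?_⟩
    rw [← huK, hu1] at h2
    have h3 : B ⟨(Q * ↑u⁻¹) x, hy⟩ = (z : ℂ) • (Q * ↑u⁻¹) x - x := h2
    rw [h3, sub_sub_cancel]
  · have h1 := hleft x
    rw [← huK] at h1
    have h2 (y : E) : Q ((↑u⁻¹ : E →L[ℂ] E) y) = (↑u⁻¹ : E →L[ℂ] E) (Q y) := by
      rw [← hu2 (Q _), hQu, hu1]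
    rw [mul_apply_eq_comp, h2, h1, hu2]
  · have h1 : ‖(↑u⁻¹ : E →L[ℂ] E)‖ ≤ 2 := by
      refine ContinuousLinearMap.opNorm_le_bound _ zero_le_two fun x => ?_
      have h2 := norm_sub_norm_le ((↑u⁻¹ : E →L[ℂ] E) x) (K ((↑u⁻¹ : E →L[ℂ] E) x))
      have h3 : (↑u⁻¹ : E →L[ℂ] E) x - K ((↑u⁻¹ : E →L[ℂ] E) x) = x := by
        have := hu1 x
        rwa [huK] at this
      have h4 := K.le_of_opNorm_le hK ((↑u⁻¹ : E →L[ℂ] E) x)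
      rw [h3] at h2
      linarith
    calc ‖Q * (↑u⁻¹ : E →L[ℂ] E)‖ ≤ ‖Q‖ * ‖(↑u⁻¹ : E →L[ℂ] E)‖ := norm_mul_le _ _
      _ ≤ M / z * 2 := by gcongr
      _ = 2 * M / z := by ring

/-- A closed operator composed with a bounded operator into its domain is bounded. -/
theorem exists_clm_comp_of_isClosed {T : E →ₗ.[ℂ] E} (hT : T.IsClosed) (R : E →L[ℂ] E)
    (hR : ∀ x, R x ∈ T.domain) : ∃ C : E →L[ℂ] E, ∀ x, C x = T ⟨R x, hR x⟩ := by
  let g : E →ₗ[ℂ] E := T.toFun ∘ₗ LinearMap.codRestrict T.domain R.toLinearMap hR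
  have hg (x : E) : (R x, g x) ∈ T.graph := LinearPMap.mem_graph T ⟨R x, hR x⟩
  refine ⟨⟨g, g.continuous_of_seq_closed_graph fun u x y hu hgu => ?_⟩, fun x => rfl⟩
  have h1 : (R x, y) ∈ T.graph := (show IsClosed (T.graph : Set (E × E)) from hT).mem_of_tendsto
    (((R.continuous.tendsto x).comp hu).prodMk_nhds hgu) (Eventually.of_forall fun k => hg (u k))
  exact T.mem_graph_snd_inj h1 (hg x) rfl

/-- If `D(B) ⊆ D(T)`, the operators `T (z - B)⁻¹` are uniformly bounded for large real `z`. -/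
theorem exists_norm_comp_resolvent_le {B : E →ₗ.[ℂ] E} {M z₀ : ℝ} (hM : 0 < M) (hz₀ : 0 < z₀)
    {R : ℝ → E →L[ℂ] E} (hR : ∀ z, z₀ ≤ z → IsResolventAt B z (R z))
    (hRM : ∀ z, z₀ ≤ z → ‖R z‖ ≤ M / z) {T : E →ₗ.[ℂ] E} (hT : T.IsClosed)
    (hBT : B.domain ≤ T.domain) :
    ∃ K : ℝ, ∀ z, z₀ ≤ z → ∃ C : E →L[ℂ] E, ‖C‖ ≤ K ∧
      ∀ x, ∃ h : R z x ∈ T.domain, C x = T ⟨R z x, h⟩ := by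
  obtain ⟨C₀, hC₀⟩ := exists_clm_comp_of_isClosed hT (R z₀)
    fun x => hBT ((hR z₀ le_rfl).mem_domain x)
  refine ⟨‖C₀‖ * (1 + M), fun z hz => ⟨C₀ * (1 - ((z : ℂ) - z₀) • R z), ?_, fun x => ?_⟩⟩
  · have hz0 : 0 < z := hz₀.trans_le hz
    refine (norm_mul_le _ _).trans (mul_le_mul_of_nonneg_left ?_ (norm_nonneg _))
    refine (norm_sub_le _ _).trans (add_le_add ContinuousLinearMap.norm_id_le ?_)
    rw [norm_smul, ← Complex.ofReal_sub, Complex.norm_real, Real.norm_of_nonneg (by linarith)]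
    calc (z - z₀) * ‖R z‖ ≤ z * (M / z) := by
          gcongr
          · linarith
          · exact hRM z hz
      _ = M := by field_simp
  · have h1 := (hR z hz).mem_domain x
    have h2 := (hR z₀ le_rfl).left_inv ⟨R z x, h1⟩
    rw [(hR z hz).apply_eq] at h2
    have h3 : (1 - ((z : ℂ) - z₀) • R z) x = (z₀ : ℂ) • R z x - ((z : ℂ) • R z x - x) := by
      simp only [_root_.sub_apply, _root_.smul_apply, one_apply_eq_self, sub_smul]
      abel
    refine ⟨hBT h1, ?_⟩
    rw [mul_apply_eq_comp, h3, hC₀]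
    exact congrArg T (Subtype.ext h2)

end Generator

/-! ### The operator matrices `Δ` and `Ψ` -/

section Matrices

variable {E : Type*} [NormedAddCommGroup E] {n : ℕ}

/-- The coordinate `y_m`, with `y_m = 0` for `m ≥ n`. -/
def coord (y : Fin n → E) (m : ℕ) : E := if h : m < n then y ⟨m, h⟩ else 0

theorem coord_of_lt (y : Fin n → E) {m : ℕ} (h : m < n) : coord y m = y ⟨m, h⟩ := dif_pos h

theorem coord_of_le (y : Fin n → E) {m : ℕ} (h : n ≤ m) : coord y m = 0 := dif_neg (by omega)

theorem coord_zero [NeZero n] (y : Fin n → E) : coord y 0 = y 0 :=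
  coord_of_lt y (NeZero.pos n)

theorem continuous_coord {y : ℝ → Fin n → E} (hy : Continuous y) (m : ℕ) :
    Continuous fun t => coord (y t) m := by
  by_cases h : m < n
  · simp only [coord_of_lt _ h]
    fun_prop
  · simp only [coord_of_le _ (not_lt.1 h)]
    fun_prop

theorem sum_ite_val_eq (y : Fin n → E) (m : ℕ) :
    ∑ j : Fin n, (if (j : ℕ) = m then y j else 0) = coord y m := by
  by_cases h : m < n
  · rw [coord_of_lt y h, Finset.sum_eq_single ⟨m, h⟩]
    · simp
    · intro j _ hj
      rw [if_neg fun hjm => hj (Fin.ext hjm)]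
    · simp
  · rw [coord_of_le y (not_lt.1 h)]
    refine Finset.sum_eq_zero fun j _ => if_neg ?_
    have := j.2
    omega

theorem sum_ite_val_lt (φ : ℕ → E) (c : E) (i : Fin n) :
    ∑ j : Fin n, (if j < i then φ j else if j = i then c else 0) =
      ∑ j ∈ Finset.range i, φ j + c := by
  have h1 (j : Fin n) : (if j < i then φ j else if j = i then c else 0) =
      (if (j : ℕ) < i then φ j else 0) + if j = i then c else 0 := by
    rcases lt_trichotomy j i with h | h | h
    · simp [h, h.ne]
    · simp [h]
    · simp [h.not_gt, h.ne']
  simp only [h1]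
  rw [Finset.sum_add_distrib, Finset.sum_ite_eq' Finset.univ i, if_pos (Finset.mem_univ i),
    Fin.sum_univ_eq_sum_range (fun j => if j < (i : ℕ) then φ j else 0) n, ← Finset.sum_filter]
  congr 2
  ext j
  have := i.2
  simp only [Finset.mem_filter, Finset.mem_range]
  omega

theorem sum_equation [NeZero n] (a : ℕ → Fin n → E) :
    a n 0 + ∑ i : Fin n, (coord (a i) (n - i) - coord (a (i + 1)) (n - (i + 1))) = 0 := by
  rw [Fin.sum_univ_eq_sum_range
      (fun i => coord (a i) (n - i) - coord (a (i + 1)) (n - (i + 1))) n,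
    Finset.sum_range_sub', Nat.sub_self, Nat.sub_zero, coord_of_le _ le_rfl, coord_zero]
  abel

variable [NormedSpace ℂ E]

theorem apply_congr {f g : E →ₗ.[ℂ] E} (h : f = g) {x y : E} (hxy : x = y) (hx : x ∈ f.domain) :
    ∃ hy : y ∈ g.domain, f ⟨x, hx⟩ = g ⟨y, hy⟩ := by
  subst h hxy
  exact ⟨hx, rfl⟩

theorem mem_opRow_domain {M : Fin n → (E →ₗ.[ℂ] E)} {x : Fin n → E} :
    x ∈ (opRow M).domain ↔ ∀ j, x j ∈ (M j).domain := by
  simp [opRow, Submodule.mem_pi]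

theorem opRow_apply (M : Fin n → (E →ₗ.[ℂ] E)) (x : (opRow M).domain) :
    opRow M x = ∑ j, M j ⟨(x : Fin n → E) j, mem_opRow_domain.1 x.2 j⟩ := by
  let D : Submodule ℂ (Fin n → E) := Submodule.pi univ fun j => (M j).domain
  exact LinearMap.sum_apply Finset.univ (fun j => (M j).toFun ∘ₗ
    LinearMap.codRestrict (M j).domain (LinearMap.proj j ∘ₗ D.subtype)
      (fun x => x.2 j (mem_univ j))) x

theorem mem_opMatrix_domain {M : Fin n → Fin n → (E →ₗ.[ℂ] E)} {x : Fin n → E} :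
    x ∈ (opMatrix M).domain ↔ ∀ i, x ∈ (opRow (M i)).domain := by
  simp [opMatrix, Submodule.mem_iInf]

variable {A : Fin n → (E →ₗ.[ℂ] E)}

section Delta

variable [NeZero n]

theorem mem_Delta_domain {x : Fin n → E} :
    x ∈ (Delta A).domain ↔ ∀ i, x 0 ∈ (A i).domain := by
  simp only [Delta, mem_opMatrix_domain, mem_opRow_domain, deltaEntry]
  constructor
  · intro h i
    have := h (Fin.rev i) 0
    simpa using this
  · intro h i j
    split_ifs with h1 h2
    · rw [h1]
      exact h _
    · exact Submodule.mem_top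
    · exact Submodule.mem_top

theorem Delta_apply {x : Fin n → E} (hx : x ∈ (Delta A).domain) (i : Fin n) :
    Delta A ⟨x, hx⟩ i =
      -A (Fin.rev i) ⟨x 0, mem_Delta_domain.1 hx _⟩ + coord x (i + 1) := by
  have h0 (j : Fin n) : deltaEntry A i j
      ⟨x j, mem_opRow_domain.1 (mem_opMatrix_domain.1 hx i) j⟩ =
      (if j = 0 then -A (Fin.rev i) ⟨x 0, mem_Delta_domain.1 hx _⟩ else 0) +
        if (j : ℕ) = i + 1 then x j else 0 := by
    by_cases h1 : j = 0
    · subst h1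
      obtain ⟨_, h⟩ := apply_congr (g := -A (Fin.rev i)) (by simp [deltaEntry]) rfl
        (mem_opRow_domain.1 (mem_opMatrix_domain.1 hx i) 0)
      rw [h, if_pos rfl, if_neg (by simp), add_zero]
      rfl
    · by_cases h2 : (j : ℕ) = i + 1
      · obtain ⟨_, h⟩ := apply_congr (g := idOp) (by simp [deltaEntry, h1, h2]) rfl
          (mem_opRow_domain.1 (mem_opMatrix_domain.1 hx i) j)
        rw [h, if_neg h1, if_pos h2, zero_add]
        rfl
      · obtain ⟨_, h⟩ := apply_congr (g := 0) (by simp [deltaEntry, h1, h2]) rfl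
          (mem_opRow_domain.1 (mem_opMatrix_domain.1 hx i) j)
        rw [h, if_neg h1, if_neg h2, zero_add]
        rfl
  refine (opRow_apply (deltaEntry A i) ⟨x, mem_opMatrix_domain.1 hx i⟩).trans ?_
  simp only [h0]
  rw [Finset.sum_add_distrib, Finset.sum_ite_eq' Finset.univ (0 : Fin n),
    if_pos (Finset.mem_univ _), sum_ite_val_eq]

/-- Along a chain of `Δ`, the values of the coefficients at the first coordinates are differences
of coordinates. -/
theorem IsChain.coefficient_apply {a : ℕ → Fin n → E} (ha : IsChain (Delta A) n a) {i j : ℕ}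
    (hji : j < i) (hi : i ≤ n) :
    ∃ h : a j 0 ∈ (A ⟨n - (i - j), by omega⟩).domain,
      A ⟨n - (i - j), by omega⟩ ⟨a j 0, h⟩ =
        coord (a j) (i - j) - coord (a (j + 1)) (i - (j + 1)) := by
  obtain ⟨h1, h2⟩ := ha j (by omega)
  refine ⟨mem_Delta_domain.1 h1 _, ?_⟩
  have h3 := Delta_apply h1 ⟨i - (j + 1), by omega⟩
  rw [h2] at h3
  rw [coord_of_lt _ (by omega : i - (j + 1) < n), h3]
  obtain ⟨_, h4⟩ := apply_congr (f := A (Fin.rev ⟨i - (j + 1), by omega⟩))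
    (g := A ⟨n - (i - j), by omega⟩) (congrArg A (Fin.ext (by simp [Fin.val_rev]; omega))) rfl
    (mem_Delta_domain.1 h1 _)
  rw [h4, show i - (j + 1) + 1 = i - j by omega]
  abel

/-- The first coordinates of a chain of `Δ` satisfy the equation of the Cauchy problem. -/
theorem IsChain.equation {a : ℕ → Fin n → E} (ha : IsChain (Delta A) n a) (i : Fin n) :
    ∃ h : a i 0 ∈ (A i).domain,
      A i ⟨a i 0, h⟩ = coord (a i) (n - i) - coord (a (i + 1)) (n - (i + 1)) := by
  obtain ⟨h1, h2⟩ := ha.coefficient_apply i.2 le_rfl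
  have h3 : A ⟨n - (n - i), by omega⟩ = A i := congrArg A (Fin.ext (by simp; omega))
  obtain ⟨h4, h5⟩ := apply_congr h3 rfl h1
  exact ⟨h4, h5 ▸ h2⟩

/-- If `a` is a chain of `Δ`, then `Ψ` maps the vector of the first coordinates of
`a 0, …, a (n - 1)` to `a 0`. -/
theorem IsChain.psiRow_apply {a : ℕ → Fin n → E} (ha : IsChain (Delta A) n a) (i : Fin n) :
    ∃ h : (fun k : Fin n => a k 0) ∈ (psiRow A i).domain,
      psiRow A i ⟨fun k : Fin n => a k 0, h⟩ = a 0 i := by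
  have hentry (j : Fin n) : ∃ h : a j 0 ∈ (psiEntry A i j).domain,
      psiEntry A i j ⟨a j 0, h⟩ =
        if j < i then coord (a j) (i - j) - coord (a (j + 1)) (i - (j + 1))
        else if j = i then a i 0 else 0 := by
    by_cases h1 : j < i
    · obtain ⟨h2, h3⟩ := ha.coefficient_apply h1 i.2.le
      obtain ⟨h4, h5⟩ := apply_congr (g := psiEntry A i j) (by simp [psiEntry, h1]) rfl h2
      exact ⟨h4, by rw [← h5, h3, if_pos h1]⟩
    · by_cases h2 : j = i
      · obtain ⟨h4, h5⟩ := apply_congr (f := idOp) (g := psiEntry A i j) (x := a j 0)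
          (by simp [psiEntry, h2]) rfl Submodule.mem_top
        refine ⟨h4, ?_⟩
        rw [← h5, if_neg h1, if_pos h2, h2]
        rfl
      · obtain ⟨h4, h5⟩ := apply_congr (f := 0) (g := psiEntry A i j) (x := a j 0)
          (by simp [psiEntry, h1, h2]) rfl Submodule.mem_top
        refine ⟨h4, ?_⟩
        rw [← h5, if_neg h1, if_neg h2]
        rfl
  choose h1 h2 using hentry
  refine ⟨mem_opRow_domain.2 h1, ?_⟩
  refine (opRow_apply (psiEntry A i) ⟨_, mem_opRow_domain.2 h1⟩).trans ?_
  simp only [h2]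
  rw [sum_ite_val_lt (fun j => coord (a j) (i - j) - coord (a (j + 1)) (i - (j + 1))),
    Finset.sum_range_sub', Nat.sub_self, Nat.sub_zero, coord_of_lt _ i.2, coord_zero]
  abel

end Delta

/-- `Ψ` is lower triangular with identities on the diagonal, hence injective. -/
theorem eq_of_psiRow_eq {v w : Fin n → E}
    (h : ∀ i, ∃ (hv : v ∈ (psiRow A i).domain) (hw : w ∈ (psiRow A i).domain),
      psiRow A i ⟨v, hv⟩ = psiRow A i ⟨w, hw⟩) : v = w := by
  funext i
  induction i using WellFoundedLT.induction with
  | ind i ih =>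
    obtain ⟨hv, hw, hvw⟩ := h i
    have hvw' := (opRow_apply (psiEntry A i) ⟨v, hv⟩).symm.trans
      (hvw.trans (opRow_apply (psiEntry A i) ⟨w, hw⟩))
    rw [← sub_eq_zero, ← Finset.sum_sub_distrib,
      Finset.sum_eq_single i] at hvw'
    · obtain ⟨_, h1⟩ := apply_congr (g := idOp) (by simp [psiEntry]) rfl (mem_opRow_domain.1 hv i)
      obtain ⟨_, h2⟩ := apply_congr (g := idOp) (by simp [psiEntry]) rfl (mem_opRow_domain.1 hw i)
      rw [h1, h2] at hvw'
      exact sub_eq_zero.1 hvw'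
    · intro j _ hj
      rcases lt_or_gt_of_ne hj with hlt | hgt
      · obtain ⟨_, h1⟩ := apply_congr rfl (ih j hlt) (mem_opRow_domain.1 hv j)
        exact sub_eq_zero.2 h1
      · obtain ⟨_, h1⟩ := apply_congr (g := 0) (by simp [psiEntry, hgt.not_gt, hgt.ne']) rfl
          (mem_opRow_domain.1 hv j)
        obtain ⟨_, h2⟩ := apply_congr (g := 0) (by simp [psiEntry, hgt.not_gt, hgt.ne']) rfl
          (mem_opRow_domain.1 hw j)
        rw [h1, h2]
        exact sub_self _
    · simp

/-! ### The resolvent of `Δ` -/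

/-- `Δ` is the sum of an operator whose only nonzero column is the first one, and of a nilpotent
shift of norm at most `1`. The resolvent of the former at `z` is explicit, and tends to `0` as
`z → ∞`. -/
theorem resolventSet_Delta_nonempty [NeZero n] [CompleteSpace E] (hclosed : ∀ i, (A i).IsClosed)
    (hgen : GeneratesC0Semigroup (-A (Fin.rev 0)))
    (hdom : ∀ j, (A (Fin.rev 0)).domain ≤ (A j).domain) :
    (resolventSet (Delta A)).Nonempty := by
  obtain ⟨M, hM, z₀, hz₀, hex⟩ := exists_resolvent_of_generator hgen
  choose! R hR hRM using hex
  choose K hK using fun i => exists_norm_comp_resolvent_le hM hz₀ hR hRM (hclosed i)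
    (show (-A (Fin.rev 0)).domain ≤ _ from hdom i)
  set K' := ∑ i, |K i|
  have hK' (i : Fin n) : K i ≤ K' := (le_abs_self _).trans
    (Finset.single_le_sum (f := fun i => |K i|) (fun _ _ => abs_nonneg _) (Finset.mem_univ i))
  have hK'0 : 0 ≤ K' := Finset.sum_nonneg fun _ _ => abs_nonneg _
  set z := max z₀ (2 * (M + 1 + K'))
  have hzz : z₀ ≤ z := le_max_left _ _
  have hz2 : 2 * (M + 1 + K') ≤ z := le_max_right _ _
  have hz : 0 < z := hz₀.trans_le hzz
  have hzc : (z : ℂ) ≠ 0 := by exact_mod_cast hz.ne'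
  choose C hCK hC using fun i => hK i z hzz
  have hRz := hR z hzz
  let π (i : Fin n) : (Fin n → E) →L[ℂ] E := ContinuousLinearMap.proj i
  let R₀ : (Fin n → E) →L[ℂ] (Fin n → E) := ContinuousLinearMap.pi fun i =>
    if i = 0 then R z ∘L π 0 else (z : ℂ)⁻¹ • (π i - C (Fin.rev i) ∘L π 0)
  have hR₀zero (x : Fin n → E) : R₀ x 0 = R z (x 0) := by simp [R₀, π]
  have hR₀ (x : Fin n → E) {i : Fin n} (hi : i ≠ 0) :
      R₀ x i = (z : ℂ)⁻¹ • (x i - C (Fin.rev i) (x 0)) := by simp [R₀, π, hi]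
  let N : (Fin n → E) →L[ℂ] (Fin n → E) := ContinuousLinearMap.pi fun i =>
    if h : (i : ℕ) + 1 < n then ContinuousLinearMap.proj ⟨i + 1, h⟩ else 0
  have hN (x : Fin n → E) (i : Fin n) : N x i = coord x (i + 1) := by
    by_cases h : (i : ℕ) + 1 < n <;> simp [N, coord, h]
  have hNnorm : ‖N‖ ≤ 1 := by
    refine ContinuousLinearMap.opNorm_le_bound _ zero_le_one fun x => ?_
    rw [one_mul]
    refine (pi_norm_le_iff_of_nonneg (norm_nonneg x)).2 fun i => ?_
    rw [hN, coord]
    split_ifs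
    · exact norm_le_pi_norm x _
    · simp
  have hR₀norm : ‖R₀‖ ≤ 1 / 2 := by
    refine ContinuousLinearMap.opNorm_le_bound _ (by norm_num) fun x => ?_
    refine (pi_norm_le_iff_of_nonneg (by positivity)).2 fun i => ?_
    have h0 := norm_le_pi_norm x 0
    have hx := norm_nonneg x
    by_cases hi : i = 0
    · subst hi
      rw [hR₀zero]
      refine ((R z).le_of_opNorm_le (hRM z hzz) _).trans ?_
      refine mul_le_mul ?_ h0 (norm_nonneg _) (by norm_num)
      rw [div_le_iff₀ hz]
      linarith
    · rw [hR₀ x hi, norm_smul, norm_inv, Complex.norm_real, Real.norm_of_nonneg hz.le,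
        inv_mul_le_iff₀ hz]
      have h1 := (C (Fin.rev i)).le_of_opNorm_le ((hCK _).trans (hK' _)) (x 0)
      have h2 := norm_sub_le (x i) (C (Fin.rev i) (x 0))
      have h3 := norm_le_pi_norm x i
      have h4 : K' * ‖x 0‖ ≤ K' * ‖x‖ := by gcongr
      nlinarith
  have hmem {x : Fin n → E} (hx : x 0 ∈ (A (Fin.rev 0)).domain) : x ∈ (Delta A).domain :=
    mem_Delta_domain.2 fun i => hdom i hx
  have hright (x : Fin n → E) : ∃ h : R₀ x ∈ (Delta A).domain,
      (z : ℂ) • R₀ x - Delta A ⟨R₀ x, h⟩ = x - N (R₀ x) := by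
    have h1 : R₀ x 0 ∈ (A (Fin.rev 0)).domain := by
      rw [hR₀zero]
      exact hRz.mem_domain (x 0)
    refine ⟨hmem h1, funext fun i => ?_⟩
    rw [Pi.sub_apply, Pi.sub_apply, Pi.smul_apply, Delta_apply, hN]
    obtain ⟨h2, h3⟩ := apply_congr (rfl : A (Fin.rev i) = _) (hR₀zero x) (hdom _ h1)
    rw [h3]
    by_cases hi : i = 0
    · subst hi
      have h4 : -A (Fin.rev 0) ⟨R z (x 0), h2⟩ = (z : ℂ) • R z (x 0) - x 0 := hRz.apply_eq (x 0)
      rw [h4, hR₀zero]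
      abel
    · obtain ⟨_, h5⟩ := hC (Fin.rev i) (x 0)
      rw [← h5, hR₀ x hi, smul_inv_smul₀ hzc]
      abel
  have hleft {x : Fin n → E} (hx : x ∈ (Delta A).domain) :
      R₀ ((z : ℂ) • x - Delta A ⟨x, hx⟩ + N x) = x := by
    have h1 (i : Fin n) : ((z : ℂ) • x - Delta A ⟨x, hx⟩ + N x) i =
        (z : ℂ) • x i + A (Fin.rev i) ⟨x 0, mem_Delta_domain.1 hx _⟩ := by
      rw [Pi.add_apply, Pi.sub_apply, Pi.smul_apply, Delta_apply, hN]
      abel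
    have h2 : R z (((z : ℂ) • x - Delta A ⟨x, hx⟩ + N x) 0) = x 0 := by
      have h3 := hRz.left_inv ⟨x 0, mem_Delta_domain.1 hx _⟩
      rw [h1, ← sub_neg_eq_add]
      exact h3
    funext i
    by_cases hi : i = 0
    · rw [hi, hR₀zero, h2]
    · obtain ⟨h4, h5⟩ := hC (Fin.rev i) (((z : ℂ) • x - Delta A ⟨x, hx⟩ + N x) 0)
      obtain ⟨h6, h7⟩ := apply_congr (rfl : A (Fin.rev i) = _) h2 h4
      rw [hR₀ _ hi, h5, h7, h1, add_sub_cancel_right, inv_smul_smul₀ hzc]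
  obtain ⟨u, hu⟩ := isUnit_one_sub_of_norm_lt_one (x := N * R₀) (by
    refine (norm_mul_le N R₀).trans_lt ?_
    nlinarith [norm_nonneg N, norm_nonneg R₀])
  have hu1 (x : Fin n → E) : (↑u⁻¹ : (Fin n → E) →L[ℂ] (Fin n → E)) x -
      N (R₀ ((↑u⁻¹ : (Fin n → E) →L[ℂ] (Fin n → E)) x)) = x := by
    have h := DFunLike.congr_fun u.mul_inv x
    rw [hu] at h
    exact h
  have hS (x : Fin n → E) : ∃ h : (R₀ * ↑u⁻¹) x ∈ (Delta A).domain,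
      (z : ℂ) • (R₀ * ↑u⁻¹) x - Delta A ⟨(R₀ * ↑u⁻¹) x, h⟩ = x := by
    obtain ⟨h1, h2⟩ := hright ((↑u⁻¹ : (Fin n → E) →L[ℂ] (Fin n → E)) x)
    rw [hu1] at h2
    exact ⟨h1, h2⟩
  refine ⟨z, R₀ * ↑u⁻¹, hS, fun ⟨x, hx⟩ => ?_⟩
  -- `z - Δ` is injective, since `(z - Δ) d = 0` means that `d = R₀ N d`
  obtain ⟨h1, h2⟩ := hS ((z : ℂ) • x - Delta A ⟨x, hx⟩)
  set y := (R₀ * ↑u⁻¹) ((z : ℂ) • x - Delta A ⟨x, hx⟩)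
  have h3 : R₀ (N (y - x)) = y - x := by
    have h4 := hleft h1
    rw [h2] at h4
    calc R₀ (N (y - x)) = R₀ ((z : ℂ) • x - Delta A ⟨x, hx⟩ + N y) -
          R₀ ((z : ℂ) • x - Delta A ⟨x, hx⟩ + N x) := by
          rw [← map_sub, add_sub_add_left_eq_sub, map_sub N]
      _ = y - x := by rw [h4, hleft hx]
  have h6 : ‖y - x‖ ≤ 1 / 2 * ‖y - x‖ := by
    calc ‖y - x‖ = ‖R₀ (N (y - x))‖ := by rw [h3]
      _ ≤ 1 / 2 * ‖N (y - x)‖ := R₀.le_of_opNorm_le hR₀norm _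
      _ ≤ 1 / 2 * ‖y - x‖ := by
        gcongr
        simpa using N.le_of_opNorm_le hNnorm (y - x)
  have h7 : ‖y - x‖ = 0 := by linarith [norm_nonneg (y - x)]
  exact sub_eq_zero.1 (norm_eq_zero.1 h7)

end Matrices

/-! ### Strong solutions -/

section Solution

theorem PositiveLowerDensity.mono {S S' : Set ℝ} (h : PositiveLowerDensity S) (hS : S ⊆ S') :
    PositiveLowerDensity S' :=
  lt_of_lt_of_le h (liminf_le_liminf (Eventually.of_forall fun t =>
    ENNReal.div_le_div_right (measure_mono (inter_subset_inter_left _ hS)) _))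

variable {E : Type*} [NormedAddCommGroup E] [NormedSpace ℂ E] {n : ℕ}

theorem contDiff_of_derivatives {f : ℕ → ℝ → E}
    (hd : ∀ k < n, ∀ t, HasDerivAt (f k) (f (k + 1) t) t)
    (hc : Continuous (f n)) : ContDiff ℝ n (f 0) := by
  have h (m : ℕ) : ∀ k, k + m = n → ContDiff ℝ m (f k) := by
    induction m with
    | zero =>
      rintro k rfl
      exact contDiff_zero.2 hc
    | succ m ih =>
      intro k hk
      have hk' := hd k (by omega)
      rw [Nat.cast_succ, contDiff_succ_iff_deriv]
      refine ⟨fun t => (hk' t).differentiableAt, by simp, ?_⟩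
      rw [show deriv (f k) = f (k + 1) from funext fun t => (hk' t).deriv]
      exact ih (k + 1) (by omega)
  exact h n 0 (zero_add n)

theorem der_eq_of_derivatives {f : ℕ → ℝ → E}
    (hd : ∀ k < n, ∀ t, HasDerivAt (f k) (f (k + 1) t) t) {k : ℕ} (hk : k ≤ n) :
    ∀ t ≥ 0, der (f 0) k t = f k t := by
  induction k with
  | zero => intro t _; simp [der]
  | succ k ih =>
    intro t ht
    rw [der, iteratedDerivWithin_succ]
    change derivWithin (der (f 0) k) (Ici 0) t = f (k + 1) t
    rw [derivWithin_congr (fun s (hs : s ∈ Ici 0) => ih (by omega) s hs) (ih (by omega) t ht)]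
    exact (hd k (by omega) t).hasDerivWithinAt.derivWithin (uniqueDiffOn_Ici 0 t ht)

theorem hasDerivAt_powResolvent {X : Type*} [NormedAddCommGroup X] [NormedSpace ℂ X]
    {R : X →L[ℂ] X} {z : ℂ} {x : ℝ → X}
    (hx : ∀ t, HasDerivAt (fun t => R (x t)) (z • R (x t) - x t) t) {k : ℕ} (hk : k < n) (t : ℝ) :
    HasDerivAt (fun t => powResolvent R z n k (x t)) (powResolvent R z n (k + 1) (x t)) t := by
  simp only [powResolvent_of_lt R z hk, powResolvent_succ]
  exact ((R ^ (n - (k + 1)) * (z • R - 1) ^ k).restrictScalars ℝ).hasFDerivAt.comp_hasDerivAt t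
    (hx t)

variable {A : Fin n → (E →ₗ.[ℂ] E)}

theorem mem_preimageOp_Psi {S : Submodule ℂ (Fin n → E)} {v : Fin n → E} :
    v ∈ preimageOp (Psi A) S ↔
      ∃ y ∈ S, ∀ i, ∃ h : v ∈ (psiRow A i).domain, psiRow A i ⟨v, h⟩ = y i := by
  constructor
  · rintro ⟨v, hv, rfl⟩
    exact ⟨Psi A v, hv, fun i => ⟨mem_opMatrix_domain.1 v.2 i, rfl⟩⟩
  · rintro ⟨y, hy, h⟩
    choose h1 h2 using h
    refine ⟨⟨v, mem_opMatrix_domain.2 h1⟩, ?_, rfl⟩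
    have h3 : Psi A ⟨v, mem_opMatrix_domain.2 h1⟩ = y := funext h2
    exact (congrArg (· ∈ S) h3).mpr hy

variable [NeZero n]

/-- If `y` is an `n` times continuously differentiable orbit of `Δ` with derivatives `Δ ^ k y`, then
its first coordinate is a strong solution with `k`-th derivative `(Δ ^ k y)_0`. -/
theorem isStrongSolution_of_orbit {Y : ℕ → ℝ → Fin n → E}
    (hchain : ∀ t, IsChain (Delta A) n fun k => Y k t)
    (hd : ∀ k < n, ∀ t, HasDerivAt (Y k) (Y (k + 1) t) t) (hc : ∀ k, Continuous (Y k)) :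
    (∀ t ≥ 0, jet n (fun t => Y 0 t 0) t = fun k : Fin n => Y k t 0) ∧
      IsStrongSolution A (fun k : Fin n => Y k 0 0) fun t => Y 0 t 0 := by
  have hd' : ∀ k < n, ∀ t, HasDerivAt (fun t => Y k t 0) (Y (k + 1) t 0) t :=
    fun k hk t => hasDerivAt_pi.1 (hd k hk t) 0
  have hder {k : ℕ} (hk : k ≤ n) {t : ℝ} (ht : t ≥ 0) : der (fun t => Y 0 t 0) k t = Y k t 0 :=
    der_eq_of_derivatives (f := fun k t => Y k t 0) hd' hk t ht
  have hjet : ∀ t ≥ 0, jet n (fun t => Y 0 t 0) t = fun k : Fin n => Y k t 0 :=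
    fun t ht => funext fun k => hder k.2.le ht
  refine ⟨hjet, ?_, ⟨fun i t => coord (Y i t) (n - i) - coord (Y (i + 1) t) (n - (i + 1)),
    fun i => ?_, fun i t ht => ?_, fun t ht => ?_⟩, hjet 0 le_rfl⟩
  · have h0 : Continuous fun t => Y n t 0 := (continuous_apply 0).comp (hc n)
    exact (contDiff_of_derivatives (f := fun k t => Y k t 0) hd' h0).contDiffOn
  · exact ((continuous_coord (hc _) _).sub (continuous_coord (hc _) _)).continuousOn
  · obtain ⟨h1, h2⟩ := (hchain t).equation i
    obtain ⟨h3, h4⟩ := apply_congr (rfl : A i = A i) (hder i.2.le ht).symm h1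
    exact ⟨h3, h4.symm.trans h2⟩
  · rw [hder le_rfl ht]
    exact sum_equation fun k => Y k t

/-- The eigenvectors `F_j(t)` lie in the closure of the initial values of decaying orbits, hence so
does the closed subspace which they span. -/
theorem topologicalClosure_span_subset_closure {X : Type*} [NormedAddCommGroup X] [NormedSpace ℂ X]
    [CompleteSpace X] {T : X →ₗ.[ℂ] X} {z : ℂ} {R : X →L[ℂ] X} (hR : IsResolventAt T z R)
    {Γ : Type*} {I : Γ → Set ℝ} {F : Γ → ℝ → X}
    (hI : ∀ j, (I j).OrdConnected ∧ (interior (I j)).Nonempty)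
    (hF : ∀ j, ContDiffOn ℝ 2 (F j) (I j))
    (heig : ∀ j, ∀ t ∈ I j, ∃ h : F j t ∈ T.domain, T ⟨F j t, h⟩ = (Complex.I * (t : ℂ)) • F j t)
    {M : Submodule ℂ X}
    (hM : M = (Submodule.span ℂ {x | ∃ j, ∃ t ∈ I j, x = F j t}).topologicalClosure) :
    (M : Set X) ⊆ closure (decayingInitialValues R z M : Set X) := by
  have hMc : IsClosed (M : Set X) := hM ▸ Submodule.isClosed_topologicalClosure _
  have : CompleteSpace M := hMc.completeSpace_coe
  have hFM (j : Γ) (t : ℝ) (ht : t ∈ I j) : F j t ∈ M := by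
    rw [hM]
    exact Submodule.le_topologicalClosure _ (Submodule.subset_span ⟨j, t, ht, rfl⟩)
  have h1 : M ≤ (decayingInitialValues R z M).topologicalClosure := by
    conv_lhs => rw [hM]
    refine Submodule.topologicalClosure_minimal _ (Submodule.span_le.2 ?_)
      (Submodule.isClosed_topologicalClosure _)
    rintro _ ⟨j, t, ht, rfl⟩
    refine mem_closure_decayingInitialValues (hI j).1 (hI j).2 (hF j) (hFM j) (fun s hs => ?_) ht
    obtain ⟨h, hs'⟩ := heig j s hs
    exact hR.smul_eq_of_eigenvector h hs'
  exact h1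

end Solution

end ACP

end

theorem theorem2p2 {E : Type*} [NormedAddCommGroup E] [NormedSpace ℂ E] [CompleteSpace E]
    [TopologicalSpace.SeparableSpace E]
    (n : ℕ) [NeZero n]
    (A : Fin n → (E →ₗ.[ℂ] E)) (hclosed : ∀ i, (A i).IsClosed)
    (hgen : ACP.GeneratesC0Semigroup (-A (Fin.rev 0)))
    (hdom : ∀ j, (A (Fin.rev 0)).domain ≤ (A j).domain)
    {Γ : Type*} (I : Γ → Set ℝ) (F : Γ → ℝ → (Fin n → E))
    (hI : ∀ j, (I j).OrdConnected ∧ (interior (I j)).Nonempty)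
    (hF : ∀ j, ContDiffOn ℝ 2 (F j) (I j))
    (heig : ∀ j, ∀ t ∈ I j, ∃ h : F j t ∈ (ACP.Delta A).domain,
      ACP.Delta A ⟨F j t, h⟩ = (Complex.I * (t : ℂ)) • F j t)
    (Etilde : Submodule ℂ (Fin n → E))
    (hEtilde : Etilde = ACP.graphClosure (ACP.Delta A) n
      (Submodule.span ℂ {x | ∃ j, ∃ t ∈ I j, x = F j t})) :
    (ACP.resolventSet (ACP.Delta A)).Nonempty ∧
    ∀ z ∈ ACP.resolventSet (ACP.Delta A),
      ACP.IsFrequentlyHypercyclic A z Set.univ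
        (ACP.preimageOp (ACP.Psi A) Etilde)
        (fun i => Etilde.map (LinearMap.proj (i : Fin n))) := by
  open ACP in
  refine ⟨resolventSet_Delta_nonempty hclosed hgen hdom, fun z hz => ?_⟩
  obtain ⟨R, hR⟩ := hz
  set S := Submodule.span ℂ {x | ∃ j, ∃ t ∈ I j, x = F j t} with hS
  have hE (v : Fin n → E) : v ∈ Etilde ↔ ∃ w ∈ S.topologicalClosure, (R ^ n) w = v := by
    rw [hEtilde]
    refine mem_graphClosure_span_iff hR n ?_ v
    rintro _ ⟨j, t, ht, rfl⟩
    exact ⟨_, heig j t ht⟩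
  have hchain (w : Fin n → E) := isChain_powResolvent hR n w
  -- the elements of `Ψ⁻¹(Etilde)` are the vectors of the first coordinates of chains
  have hpre (v : Fin n → E) (hv : v ∈ preimageOp (Psi A) Etilde) :
      ∃ w ∈ S.topologicalClosure, v = (fun k : Fin n => powResolvent R z n k w 0) ∧
        ∀ i, ∃ h : v ∈ (psiRow A i).domain, psiRow A i ⟨v, h⟩ = (R ^ n) w i := by
    obtain ⟨y, hy, hvy⟩ := mem_preimageOp_Psi.1 hv
    obtain ⟨w, hw, rfl⟩ := (hE y).1 hy
    refine ⟨w, hw, eq_of_psiRow_eq (A := A) fun i => ?_, hvy⟩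
    obtain ⟨h1, h2⟩ := hvy i
    obtain ⟨h3, h4⟩ := (hchain w).psiRow_apply i
    rw [powResolvent_zero] at h4
    exact ⟨h1, h3, h2.trans h4.symm⟩
  refine ⟨univ_nonempty, fun v hv i => ?_, R, hR, ?_⟩
  · obtain ⟨w, -, rfl, -⟩ := hpre v hv
    exact mem_Delta_domain.1 (hchain w i i.2).1 _
  obtain ⟨x, hxc, hxM, hxd, hx⟩ := exists_frequentlyHypercyclic_orbit
    (Submodule.isClosed_topologicalClosure S)
    (topologicalClosure_span_subset_closure hR hI hF heig rfl)
  obtain ⟨hjet, hsol⟩ := isStrongSolution_of_orbit (A := A)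
    (Y := fun k t => powResolvent R z n k (x t)) (fun t => hchain (x t))
    (fun k hk t => hasDerivAt_powResolvent hxd hk t)
    (fun k => (powResolvent R z n k).continuous.comp hxc)
  have hrow (t : ℝ) (ht : t ≥ 0) (i : Fin n) :
      ∃ h : jet n (fun t => powResolvent R z n 0 (x t) 0) t ∈ (psiRow A i).domain,
        psiRow A i ⟨jet n (fun t => powResolvent R z n 0 (x t) 0) t, h⟩ = (R ^ n) (x t) i := by
    obtain ⟨h1, h2⟩ := (hchain (x t)).psiRow_apply i
    rw [powResolvent_zero] at h2
    simp only [hjet t ht]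
    exact ⟨h1, h2⟩
  refine ⟨_, _, ?_, hsol, fun t ht i _ => (hrow t ht i).1, fun V hV hmeet => ?_⟩
  · refine mem_preimageOp_Psi.2 ⟨(R ^ n) (x 0), (hE _).2 ⟨x 0, hxM 0, rfl⟩, fun i => ?_⟩
    have h := hrow 0 le_rfl i
    simp only [hjet 0 le_rfl] at h
    exact h
  · obtain ⟨v, hv, hmeet⟩ := hmeet
    obtain ⟨w, hw, -, hvw⟩ := hpre v hv
    have hp (i : Fin n) : ∃ p ∈ V, (R ^ n) p i = (R ^ n) w i := by
      obtain ⟨h1, ⟨_, ⟨p, hp, rfl⟩, hpv⟩, -⟩ := hmeet ⟨i, mem_univ i⟩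
      obtain ⟨_, h2⟩ := hvw i
      exact ⟨p, hp, hpv.trans h2⟩
    choose p hpV hpw using hp
    have hε : ∃ ε > 0, ∀ i, Metric.ball (p i) ε ⊆ V := by
      choose r hr hrV using fun i => Metric.isOpen_iff.1 hV (p i) (hpV i)
      refine ⟨Finset.univ.inf' Finset.univ_nonempty r, ?_, fun i => ?_⟩
      · simpa using hr
      · exact (Metric.ball_subset_ball (Finset.inf'_le r (Finset.mem_univ i))).trans (hrV i)
    obtain ⟨ε, hε, hball⟩ := hε
    refine (hx w hw ε hε).mono fun t ht => ⟨ht.1, fun i => ?_⟩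
    obtain ⟨h1, h2⟩ := hrow t ht.1 i
    refine ⟨h1, ?_⟩
    rw [h2]
    -- only the `i`-th coordinate of `R ^ n (p i)` is prescribed, so `p i` is moved by `x t - w`
    refine ⟨⟨_, ⟨p i + (x t - w), hball i ?_, rfl⟩, ?_⟩, _, (hE _).2 ⟨x t, hxM t, rfl⟩, rfl⟩
    · rw [Metric.mem_ball, dist_eq_norm, add_sub_cancel_left]
      exact ht.2
    · simp only [map_add, map_sub, Pi.add_apply, Pi.sub_apply, hpw]
      abel
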